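/- For $A\subseteq\omega$ let $\overline\rho(A)=\limsup_n |A\cap[0,n)|/n$ be its upper density. Call $A,B\subseteq\omega$ coarsely similar if $\lim_n |(A\bigtriangleup B)\cap[0,n)|/n=0$, let $[A]$ be the coarse similarity class of $A$, let $\mathcal S$ be the set of all coarse similarity classes, and equip $\mathcal S$ with the metric $\delta([A],[B])=\overline\rho(A\bigtriangleup B)$. A Turing ideal is a collection $U$ of subsets of $\omega$ that is closed downward under Turing reducibility $\leq_T$ and closed under joins $A\oplus B=\{2n:n\in A\}\cup\{2n+1:n\in B\}$. Write $C'$ for the Turing jump of $C$. Theorem. Let $U$ be a Turing ideal such that the subspace $\mathcal U=\{[A]:A\in U\}$ of $(\mathcal S,\delta)$ that it generates is nonempty. Then $\mathcal U$ is closed in $(\mathcal S,\delta)$ if and only if it is complete, and $\mathcal U$ is closed if and only if both of the following hold: 1. $U$ is jump-cofinal in the Turing degrees: for every $X\subseteq\omega$ there is a $C\in U$ such that $X\leq_T C'$; 2. every countable subset of $U$ has an upper bound in $U$: for every countable $V\subseteq U$ there is a $C\in U$ such that $A\leq_T C$ for all $A\in V$. -/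

import Mathlib

open Filter Topology
open scoped symmDiff

noncomputable section

/-! ## Density and coarse similarity -/

/-- The density `ρ_n(A) = |A ∩ [0,n)| / n` of `A` at `n` (only `n ≥ 1` is meaningful; the value at
`n = 0` does not influence limits). -/
def densityAt (A : Set ℕ) (n : ℕ) : ℝ := ((A ∩ Set.Iio n).ncard : ℝ) / (n : ℝ)

/-- The upper density `limsup_n ρ_n(A)`. -/
def upperDensity (A : Set ℕ) : ℝ := limsup (densityAt A) atTop

/-- `A` and `B` are coarsely similar if their symmetric difference has asymptotic density `0`. -/
def CoarselySimilar (A B : Set ℕ) : Prop := Tendsto (densityAt (A ∆ B)) atTop (𝓝 0)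

theorem densityAt_nonneg (A : Set ℕ) (n : ℕ) : 0 ≤ densityAt A n := by
  unfold densityAt; positivity

theorem densityAt_le_one (A : Set ℕ) (n : ℕ) : densityAt A n ≤ 1 := by
  unfold densityAt
  apply div_le_one_of_le₀ _ (by positivity)
  have h := Set.ncard_le_ncard (Set.inter_subset_right : A ∩ Set.Iio n ⊆ Set.Iio n)
    (Set.finite_Iio n)
  have h2 : (Set.Iio n).ncard = n := by
    rw [← Finset.coe_Iio, Set.ncard_coe_finset]; simp
  rw [h2] at h
  exact_mod_cast h

theorem densityAt_symmDiff_triangle (A B C : Set ℕ) (n : ℕ) :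
    densityAt (A ∆ C) n ≤ densityAt (A ∆ B) n + densityAt (B ∆ C) n := by
  unfold densityAt
  rw [← add_div]
  apply div_le_div_of_nonneg_right _ (by positivity)
  have hsub : (A ∆ C) ∩ Set.Iio n ⊆ ((A ∆ B) ∩ Set.Iio n) ∪ ((B ∆ C) ∩ Set.Iio n) := by
    rw [← Set.union_inter_distrib_right]
    exact Set.inter_subset_inter_left _ (symmDiff_triangle A B C)
  have h := (Set.ncard_le_ncard hsub (((Set.finite_Iio n).inter_of_right _).union
    ((Set.finite_Iio n).inter_of_right _))).trans (Set.ncard_union_le _ _)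
  exact_mod_cast h

theorem isBoundedUnder_densityAt (A : Set ℕ) :
    IsBoundedUnder (· ≤ ·) atTop (densityAt A) :=
  isBoundedUnder_of ⟨1, densityAt_le_one A⟩

theorem isBoundedUnder_ge_densityAt (A : Set ℕ) :
    IsBoundedUnder (· ≥ ·) atTop (densityAt A) :=
  isBoundedUnder_of ⟨0, densityAt_nonneg A⟩

theorem upperDensity_nonneg (A : Set ℕ) : 0 ≤ upperDensity A :=
  le_limsup_of_frequently_le (Frequently.of_forall (densityAt_nonneg A))
    (isBoundedUnder_densityAt A)

theorem upperDensity_triangle (A B C : Set ℕ) :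
    upperDensity (A ∆ C) ≤ upperDensity (A ∆ B) + upperDensity (B ∆ C) := by
  unfold upperDensity
  refine le_trans (limsup_le_limsup (Eventually.of_forall (densityAt_symmDiff_triangle A B C))
    (isBoundedUnder_ge_densityAt _).isCoboundedUnder_le
    (isBoundedUnder_of ⟨2, fun n => ?_⟩)) ?_
  · linarith [densityAt_le_one (A ∆ B) n, densityAt_le_one (B ∆ C) n]
  · exact limsup_add_le (isBoundedUnder_ge_densityAt _) (isBoundedUnder_densityAt _)
      (isBoundedUnder_ge_densityAt _).isCoboundedUnder_le (isBoundedUnder_densityAt _)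

theorem upperDensity_symmDiff_eq_zero_iff (A B : Set ℕ) :
    upperDensity (A ∆ B) = 0 ↔ CoarselySimilar A B := by
  constructor
  · intro h
    refine tendsto_of_le_liminf_of_limsup_le ?_ h.le (isBoundedUnder_densityAt _)
      (isBoundedUnder_ge_densityAt _)
    exact le_liminf_of_le (isBoundedUnder_densityAt _).isCoboundedUnder_ge
      (Eventually.of_forall (densityAt_nonneg _))
  · intro h
    exact Tendsto.limsup_eq h

theorem upperDensity_symmDiff_self (A : Set ℕ) : upperDensity (A ∆ A) = 0 := by
  rw [upperDensity_symmDiff_eq_zero_iff]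
  have h : densityAt (A ∆ A) = fun _ => 0 := by
    funext n; simp [densityAt]
  rw [CoarselySimilar, h]
  exact tendsto_const_nhds

theorem upperDensity_symmDiff_comm (A B : Set ℕ) :
    upperDensity (A ∆ B) = upperDensity (B ∆ A) := by rw [symmDiff_comm]

/-- Coarse similarity as an equivalence relation on subsets of `ℕ`. -/
def coarseSetoid : Setoid (Set ℕ) where
  r := CoarselySimilar
  iseqv :=
    { refl := fun A => (upperDensity_symmDiff_eq_zero_iff A A).1 (upperDensity_symmDiff_self A)
      symm := fun {A B} h => by
        rw [← upperDensity_symmDiff_eq_zero_iff] at h ⊢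
        rwa [upperDensity_symmDiff_comm]
      trans := fun {A B C} h₁ h₂ => by
        rw [← upperDensity_symmDiff_eq_zero_iff] at h₁ h₂ ⊢
        have := upperDensity_triangle A B C
        exact le_antisymm (by linarith) (upperDensity_nonneg _) }

/-- The space `𝒮` of coarse similarity classes. -/
def CoarseClass : Type := Quotient coarseSetoid

/-- The coarse similarity class `[A]`. -/
def coarseClass (A : Set ℕ) : CoarseClass := Quotient.mk coarseSetoid A

theorem upperDensity_symmDiff_congr (A B A' B' : Set ℕ) (hA : CoarselySimilar A A')
    (hB : CoarselySimilar B B') : upperDensity (A ∆ B) = upperDensity (A' ∆ B') := by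
  rw [← upperDensity_symmDiff_eq_zero_iff] at hA hB
  have h1 := upperDensity_triangle A A' B
  have h2 := upperDensity_triangle A' B' B
  have h3 := upperDensity_triangle A' A B'
  have h4 := upperDensity_triangle A B B'
  rw [upperDensity_symmDiff_comm B' B] at h2
  rw [upperDensity_symmDiff_comm A' A] at h3
  linarith

/-- The metric `δ([A],[B]) = upper density of A ∆ B`. -/
def coarseDist (a b : CoarseClass) : ℝ :=
  Quotient.liftOn₂ a b (fun A B => upperDensity (A ∆ B)) upperDensity_symmDiff_congr

instance CoarseClass.instMetricSpace : MetricSpace CoarseClass where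
  dist := coarseDist
  dist_self a := Quotient.inductionOn a upperDensity_symmDiff_self
  dist_comm a b := Quotient.inductionOn₂ a b upperDensity_symmDiff_comm
  dist_triangle a b c := Quotient.inductionOn₃ a b c upperDensity_triangle
  eq_of_dist_eq_zero {a b} := Quotient.inductionOn₂ a b fun A B h =>
    Quotient.sound ((upperDensity_symmDiff_eq_zero_iff A B).1 h)

theorem dist_coarseClass (A B : Set ℕ) :
    dist (coarseClass A) (coarseClass B) = upperDensity (A ∆ B) := rfl

/-- The subset `{[A] : A ∈ U}` of `𝒮` generated by `U`. -/
def generatedSubspace (U : Set (Set ℕ)) : Set CoarseClass := coarseClass '' U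

/-! ## Turing reducibility, the jump, Turing ideals -/

open Classical in
/-- The characteristic function of a set, as a (total) element of `ℕ →. ℕ`. -/
def charFn (A : Set ℕ) : ℕ →. ℕ := fun n => Part.some (if n ∈ A then 1 else 0)

/-- Turing reducibility of sets, `A ≤_T B`. -/
def TuringLE (A B : Set ℕ) : Prop := TuringReducible (charFn A) (charFn B)

/-- The join `A ⊕ B = {2n : n ∈ A} ∪ {2n+1 : n ∈ B}`. -/
def turingJoin (A B : Set ℕ) : Set ℕ :=
  (fun n => 2 * n) '' A ∪ (fun n => 2 * n + 1) '' B

open Classical in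
/-- The initial segment `A ↾ s` of (the characteristic function of) `A`, as a string of
length `s`. -/
def initSeg (A : Set ℕ) (s : ℕ) : List Bool := (List.range s).map fun i => decide (i ∈ A)

/-- The `e`-th Turing functional with oracle `A`, written `Φ_e^A`: on input `x`, run the `e`-th
machine on the inputs `(x, A ↾ s)`, for all lengths `s` and all numbers `k` of steps in turn, and
output the result of the first computation that is found to converge. Machines are numbered by
Mathlib's codes for partial recursive functions, so the numbering is effective, uniformly in `A`.
By `charFn_recursiveIn_iff` below, the `Φ_e^A` are exactly the `A`-computable partial functions. -/
def turingFunctional (e : ℕ) (A : Set ℕ) : ℕ →. ℕ := fun x =>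
  Nat.rfindOpt fun t =>
    Nat.Partrec.Code.evaln t.unpair.1 (Denumerable.ofNat Nat.Partrec.Code e)
      (Nat.pair x (Encodable.encode (initSeg A t.unpair.2)))

set_option maxHeartbeats 1000000 in
open Classical in
/-- Finite approximations of an `A`-computable partial function `f`: a partial computable `F` such
that every value of `F (x, A ↾ s)` is correct, and every value of `f` is found from all
sufficiently long initial segments of `A`. -/
theorem exists_approx_of_recursiveIn (A : Set ℕ) {f : ℕ →. ℕ}
    (hf : Nat.RecursiveIn {charFn A} f) :
    ∃ F : ℕ × List Bool →. ℕ, Partrec F ∧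
      (∀ x s y, y ∈ F (x, initSeg A s) → y ∈ f x) ∧
      (∀ x y, y ∈ f x → ∀ᶠ s in atTop, y ∈ F (x, initSeg A s)) := by
  induction hf with
  | zero =>
    exact ⟨fun _ => Part.some 0, Computable.partrec (f := fun _ => 0) (Computable.const 0),
      fun x s y h => h, fun x y h => Eventually.of_forall fun s => h⟩
  | succ =>
    exact ⟨fun p => Part.some p.1.succ,
      Computable.partrec (f := fun p : ℕ × List Bool => p.1.succ)
        (Computable.succ.comp Computable.fst),
      fun x s y h => h, fun x y h => Eventually.of_forall fun s => h⟩
  | left =>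
    exact ⟨fun p => Part.some p.1.unpair.1,
      Computable.partrec (f := fun p : ℕ × List Bool => p.1.unpair.1)
        (Computable.fst.comp (Computable.unpair.comp Computable.fst)),
      fun x s y h => h, fun x y h => Eventually.of_forall fun s => h⟩
  | right =>
    exact ⟨fun p => Part.some p.1.unpair.2,
      Computable.partrec (f := fun p : ℕ × List Bool => p.1.unpair.2)
        (Computable.snd.comp (Computable.unpair.comp Computable.fst)),
      fun x s y h => h, fun x y h => Eventually.of_forall fun s => h⟩
  | oracle g hg =>
    rw [Set.mem_singleton_iff] at hg
    subst hg
    have key : ∀ x s, (initSeg A s)[x]? = if x < s then some (decide (x ∈ A)) else none := by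
      intro x s
      by_cases h : x < s
      · simp [initSeg, h]
      · simp [initSeg, h]
    refine ⟨fun p => (Part.ofOption (p.2[p.1]?)).map fun b => cond b 1 0, ?_, ?_, ?_⟩
    · refine Partrec.map ?_ ?_
      · exact Computable.ofOption
          (Computable.list_getElem?.comp Computable.snd Computable.fst)
      · exact (Computable.cond Computable.snd (Computable.const 1) (Computable.const 0)).to₂
    · intro x s y h
      simp only [key] at h
      by_cases hx : x < s
      · simp only [hx, if_true, Part.coe_some, Part.map_some, Part.mem_some_iff] at h
        subst h
        by_cases hA : x ∈ A <;> simp [charFn, hA]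
      · simp [hx] at h
    · intro x y h
      filter_upwards [eventually_gt_atTop x] with s hs
      simp only [key, hs, if_true, Part.coe_some, Part.map_some]
      by_cases hA : x ∈ A <;> simpa [charFn, hA] using h
  | @pair f h _ _ ihf ihh =>
    obtain ⟨F, pF, sF, cF⟩ := ihf
    obtain ⟨H, pH, sH, cH⟩ := ihh
    refine ⟨fun p => (F p).bind fun a => (H p).map fun b => Nat.pair a b, ?_, ?_, ?_⟩
    · have h1 : Computable fun z : ((ℕ × List Bool) × ℕ) × ℕ => Nat.pair z.1.2 z.2 :=
        (Primrec₂.natPair.comp (Primrec.snd.comp Primrec.fst) Primrec.snd).to_comp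
      have h2 : Partrec fun z : (ℕ × List Bool) × ℕ => (H z.1).map fun b => Nat.pair z.2 b :=
        Partrec.map (pH.comp Computable.fst) h1.to₂
      exact pF.bind h2.to₂
    · intro x s y hy
      simp only [Part.mem_bind_iff, Part.mem_map_iff] at hy
      obtain ⟨a, ha, b, hb, rfl⟩ := hy
      simp only [Seq.seq, Part.map_eq_map, Part.mem_bind_iff, Part.mem_map_iff]
      exact ⟨_, ⟨a, sF _ _ _ ha, rfl⟩, b, sH _ _ _ hb, rfl⟩
    · intro x y hy
      simp only [Seq.seq, Part.map_eq_map, Part.mem_bind_iff,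
        Part.mem_map_iff] at hy
      obtain ⟨_, ⟨a, ha, rfl⟩, b, hb, rfl⟩ := hy
      filter_upwards [cF _ _ ha, cH _ _ hb] with s h1 h2
      simp only [Part.mem_bind_iff, Part.mem_map_iff]
      exact ⟨a, h1, b, h2, rfl⟩
  | @comp f h _ _ ihf ihh =>
    obtain ⟨F, pF, sF, cF⟩ := ihf
    obtain ⟨H, pH, sH, cH⟩ := ihh
    refine ⟨fun p => (H p).bind fun a => F (a, p.2), ?_, ?_, ?_⟩
    · exact pH.bind (pF.comp (Computable.snd.pair
        (Computable.snd.comp Computable.fst))).to₂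
    · intro x s y hy
      simp only [Part.mem_bind_iff] at hy
      obtain ⟨a, ha, hb⟩ := hy
      exact Part.mem_bind_iff.2 ⟨a, sH _ _ _ ha, sF _ _ _ hb⟩
    · intro x y hy
      obtain ⟨a, ha, hb⟩ := Part.mem_bind_iff.1 hy
      filter_upwards [cH _ _ ha, cF _ _ hb] with s h1 h2
      exact Part.mem_bind_iff.2 ⟨a, h1, h2⟩
  | @prec f h _ _ ihf ihh =>
    obtain ⟨F, pF, sF, cF⟩ := ihf
    obtain ⟨H, pH, sH, cH⟩ := ihh
    refine ⟨fun p => p.1.unpair.2.rec (F (p.1.unpair.1, p.2)) fun y IH =>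
      IH.bind fun i => H (Nat.pair p.1.unpair.1 (Nat.pair y i), p.2), ?_, ?_, ?_⟩
    · refine Partrec.nat_rec (f := fun p : ℕ × List Bool => p.1.unpair.2)
        (g := fun p => F (p.1.unpair.1, p.2))
        (h := fun p q => H (Nat.pair p.1.unpair.1 (Nat.pair q.1 q.2), p.2)) ?_ ?_ ?_
      · exact Computable.snd.comp (Computable.unpair.comp Computable.fst)
      · exact pF.comp ((Computable.fst.comp (Computable.unpair.comp Computable.fst)).pair
          Computable.snd)
      · have h1 : Computable fun z : (ℕ × List Bool) × (ℕ × ℕ) =>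
            (Nat.pair z.1.1.unpair.1 (Nat.pair z.2.1 z.2.2), z.1.2) :=
          (Primrec.pair (Primrec₂.natPair.comp
            (Primrec.fst.comp (Primrec.unpair.comp (Primrec.fst.comp Primrec.fst)))
            (Primrec₂.natPair.comp (Primrec.fst.comp Primrec.snd)
              (Primrec.snd.comp Primrec.snd))) (Primrec.snd.comp Primrec.fst)).to_comp
        exact (pH.comp h1).to₂
    · intro x s
      dsimp only
      generalize x.unpair.1 = a
      induction x.unpair.2 with
      | zero => intro y hy; exact sF _ _ _ hy
      | succ n ih =>
        intro y hy
        obtain ⟨i, hi, hy⟩ := Part.mem_bind_iff.1 hy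
        exact Part.mem_bind_iff.2 ⟨i, ih i hi, sH _ _ _ hy⟩
    · intro x
      dsimp only
      generalize x.unpair.1 = a
      induction x.unpair.2 with
      | zero => intro y hy; exact cF _ _ hy
      | succ n ih =>
        intro y hy
        obtain ⟨i, hi, hy⟩ := Part.mem_bind_iff.1 hy
        filter_upwards [ih i hi, cH _ _ hy] with s h1 h2
        exact Part.mem_bind_iff.2 ⟨i, h1, h2⟩
  | @rfind f _ ihf =>
    obtain ⟨F, pF, sF, cF⟩ := ihf
    refine ⟨fun p => Nat.rfind fun n =>
      (F (Nat.pair p.1 n, p.2)).map fun m => decide (m = 0), ?_, ?_, ?_⟩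
    · have h1 : Computable fun z : (ℕ × List Bool) × ℕ => (Nat.pair z.1.1 z.2, z.1.2) :=
        (Primrec.pair (Primrec₂.natPair.comp (Primrec.fst.comp Primrec.fst) Primrec.snd)
          (Primrec.snd.comp Primrec.fst)).to_comp
      have h2 : Computable fun z : ((ℕ × List Bool) × ℕ) × ℕ => decide (z.2 = 0) :=
        (Primrec.eq.decide.comp Primrec.snd (Primrec.const 0)).to_comp
      exact Partrec.rfind (Partrec.map (pF.comp h1) h2.to₂).to₂
    · intro x s y hy
      obtain ⟨ht, hlt⟩ := Nat.mem_rfind.1 hy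
      obtain ⟨m, hm, h0⟩ := (Part.mem_map_iff _).1 ht
      refine Nat.mem_rfind.2 ⟨(Part.mem_map_iff _).2 ⟨m, sF _ _ _ hm, h0⟩, fun {k} hk => ?_⟩
      obtain ⟨m', hm', h1⟩ := (Part.mem_map_iff _).1 (hlt hk)
      exact (Part.mem_map_iff _).2 ⟨m', sF _ _ _ hm', h1⟩
    · intro x y hy
      obtain ⟨ht, hlt⟩ := Nat.mem_rfind.1 hy
      obtain ⟨m, hm, h0⟩ := (Part.mem_map_iff _).1 ht
      have hall : ∀ᶠ s in atTop, ∀ k ∈ Finset.range y,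
          ∃ m', m' ∈ F (Nat.pair x k, initSeg A s) ∧ decide (m' = 0) = false := by
        rw [Finset.eventually_all]
        intro k hk
        obtain ⟨m', hm', h1⟩ := (Part.mem_map_iff _).1 (hlt (Finset.mem_range.1 hk))
        filter_upwards [cF _ _ hm'] with s hs
        exact ⟨m', hs, h1⟩
      filter_upwards [cF _ _ hm, hall] with s h1 h2
      exact Nat.mem_rfind.2 ⟨(Part.mem_map_iff _).2 ⟨m, h1, h0⟩,
        fun {k} hk => (Part.mem_map_iff _).2 (h2 k (Finset.mem_range.2 hk))⟩

/-- The function `t ↦ A ↾ t` is computable in `A`. -/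
theorem initSeg_recursiveIn (A : Set ℕ) : Nat.RecursiveIn {charFn A}
    (fun t => Part.some (Encodable.encode (initSeg A t))) := by
  let G : ℕ → ℕ := fun p => Encodable.encode
    (((Encodable.decode p.unpair.1 : Option (List Bool)).getD []) ++ [decide (p.unpair.2 = 1)])
  have hG : Primrec G := by
    have h1 : Primrec fun p : ℕ =>
        ((Encodable.decode p.unpair.1 : Option (List Bool)).getD []) :=
      Primrec.option_getD.comp (Primrec.decode.comp (Primrec.fst.comp Primrec.unpair))
        (Primrec.const [])
    have h2 : Primrec fun p : ℕ => decide (p.unpair.2 = 1) :=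
      Primrec.eq.decide.comp (Primrec.snd.comp Primrec.unpair) (Primrec.const 1)
    exact Primrec.encode.comp (Primrec.list_concat.comp h1 h2)
  have lift : ∀ {g : ℕ → ℕ}, Primrec g → Nat.RecursiveIn {charFn A} (g : ℕ →. ℕ) :=
    fun hg => (Partrec.nat_iff.1 hg.to_comp.partrec).recursiveIn
  have h0 := lift (Primrec.const (Encodable.encode ([] : List Bool)))
  have hy : Nat.RecursiveIn {charFn A} ((fun p => p.unpair.2.unpair.1 : ℕ → ℕ) : ℕ →. ℕ) :=
    lift (Primrec.fst.comp (Primrec.unpair.comp (Primrec.snd.comp Primrec.unpair)))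
  have hi : Nat.RecursiveIn {charFn A} ((fun p => p.unpair.2.unpair.2 : ℕ → ℕ) : ℕ →. ℕ) :=
    lift (Primrec.snd.comp (Primrec.unpair.comp (Primrec.snd.comp Primrec.unpair)))
  have hp : Nat.RecursiveIn {charFn A} ((fun t => Nat.pair 0 t : ℕ → ℕ) : ℕ →. ℕ) :=
    lift (Primrec₂.natPair.comp (Primrec.const 0) Primrec.id)
  have hstep := Nat.RecursiveIn.comp (lift hG)
    (Nat.RecursiveIn.pair hi (Nat.RecursiveIn.comp (.oracle (charFn A) rfl) hy))
  refine (Nat.RecursiveIn.comp (Nat.RecursiveIn.prec h0 hstep) hp).of_eq fun t => ?_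
  simp only [PFun.coe_val, Part.bind_eq_bind, Part.bind_some, Nat.unpair_pair]
  have hbind : ∀ (a : ℕ) (g : ℕ →. ℕ), (Part.some a >>= g) = g a := fun a g => Part.bind_some a g
  induction t with
  | zero => simp [initSeg]
  | succ n ih =>
    simp only [ih]
    by_cases hA : n ∈ A <;>
      simp [charFn, hA, G, initSeg, List.range_succ, Seq.seq, hbind]

set_option maxHeartbeats 1000000 in
/-- The partial functions `Φ_e^A` are exactly the partial functions computable with oracle `A`. -/
theorem charFn_recursiveIn_iff (A : Set ℕ) (f : ℕ →. ℕ) :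
    RecursiveIn {charFn A} f ↔ ∃ e, turingFunctional e A = f := by
  rw [RecursiveIn.iff_nat]
  constructor
  · intro hf
    obtain ⟨F, pF, sF, cF⟩ := exists_approx_of_recursiveIn A hf
    obtain ⟨c, hc⟩ := Nat.Partrec.Code.exists_code.1 pF
    have hcF : ∀ x σ, c.eval (Nat.pair x (Encodable.encode σ)) = F (x, σ) := by
      intro x σ
      rw [hc]
      have : Encodable.decode (α := ℕ × List Bool) (Nat.pair x (Encodable.encode σ))
          = some (x, σ) := Encodable.encodek (α := ℕ × List Bool) (x, σ)
      simp [this, Part.map_id']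
    have hsound : ∀ x y, y ∈ turingFunctional (Encodable.encode c) A x → y ∈ f x := by
      intro x y hy
      obtain ⟨t, ht⟩ := Nat.rfindOpt_spec hy
      rw [Denumerable.ofNat_encode] at ht
      have := Nat.Partrec.Code.evaln_sound ht
      rw [hcF] at this
      exact sF _ _ _ this
    refine ⟨Encodable.encode c, funext fun x => Part.ext fun y => ⟨hsound x y, fun hy => ?_⟩⟩
    obtain ⟨s, hs⟩ := (cF x y hy).exists
    rw [← hcF] at hs
    obtain ⟨k, hk⟩ := Nat.Partrec.Code.evaln_complete.1 hs
    have hdom : (turingFunctional (Encodable.encode c) A x).Dom := by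
      refine Nat.rfindOpt_dom.2 ⟨Nat.pair k s, y, ?_⟩
      simpa only [Nat.unpair_pair, Denumerable.ofNat_encode] using hk
    have h2 := hsound x _ (Part.get_mem hdom)
    rw [Part.mem_unique hy h2]
    exact Part.get_mem hdom
  · rintro ⟨e, rfl⟩
    let E : ℕ → Option ℕ := fun p =>
      Nat.Partrec.Code.evaln p.unpair.1.unpair.2.unpair.1
        (Denumerable.ofNat Nat.Partrec.Code e) (Nat.pair p.unpair.1.unpair.1 p.unpair.2)
    have hE : Computable E := by
      have h1 : Primrec fun p : ℕ => p.unpair.1 := Primrec.fst.comp Primrec.unpair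
      have h2 : Primrec fun p : ℕ => p.unpair.2 := Primrec.snd.comp Primrec.unpair
      have h3 : Primrec fun p : ℕ => ((p.unpair.1.unpair.2.unpair.1,
          Denumerable.ofNat Nat.Partrec.Code e), Nat.pair p.unpair.1.unpair.1 p.unpair.2) :=
        Primrec.pair (Primrec.pair (h1.comp (h2.comp h1)) (Primrec.const _))
          (Primrec₂.natPair.comp (h1.comp h1) h2)
      exact (Nat.Partrec.Code.primrec_evaln.comp h3).to_comp
    have hq : Nat.RecursiveIn {charFn A} (fun q : ℕ => Part.some
        (Nat.pair q (Encodable.encode (initSeg A q.unpair.2.unpair.2)))) := by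
      have hid : Nat.RecursiveIn {charFn A} ((id : ℕ → ℕ) : ℕ →. ℕ) :=
        (Partrec.nat_iff.1 Computable.id.partrec).recursiveIn
      have h2 : Computable fun p : ℕ => p.unpair.2.unpair.2 :=
        Computable.snd.comp (Computable.unpair.comp (Computable.snd.comp Computable.unpair))
      refine (Nat.RecursiveIn.pair hid (Nat.RecursiveIn.comp (initSeg_recursiveIn A)
        (Partrec.nat_iff.1 h2.partrec).recursiveIn)).of_eq fun q => ?_
      simp [Seq.seq]
    have htest : Nat.RecursiveIn {charFn A}
        ((fun p => cond (E p).isSome 0 1 : ℕ → ℕ) : ℕ →. ℕ) :=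
      (Partrec.nat_iff.1 (Computable.cond (Primrec.option_isSome.to_comp.comp hE)
        (Computable.const 0) (Computable.const 1)).partrec).recursiveIn
    have hval : Nat.RecursiveIn {charFn A} (fun p => Part.ofOption (E p)) :=
      (Partrec.nat_iff.1 (Computable.ofOption hE)).recursiveIn
    have hid : Nat.RecursiveIn {charFn A} ((id : ℕ → ℕ) : ℕ →. ℕ) :=
      (Partrec.nat_iff.1 Computable.id.partrec).recursiveIn
    have hfind := Nat.RecursiveIn.rfind (htest.comp hq)
    refine ((hval.comp hq).comp (hid.pair hfind)).of_eq fun x => ?_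
    have hbind : ∀ (a : ℕ) (g : ℕ →. ℕ), (Part.some a >>= g) = g a := fun a g => Part.bind_some a g
    have hrf : (fun n => (fun m => decide (m = 0)) <$>
        ((Part.some (Nat.pair (Nat.pair x n) (Encodable.encode
          (initSeg A (Nat.pair x n).unpair.2.unpair.2)))) >>=
          ((fun p => cond (E p).isSome 0 1 : ℕ → ℕ) : ℕ →. ℕ)))
        = (fun n => Part.some (E (Nat.pair (Nat.pair x n) (Encodable.encode
          (initSeg A n.unpair.2)))).isSome : ℕ →. Bool) := by
      funext n
      simp only [hbind, Nat.unpair_pair, PFun.coe_val, Part.map_eq_map, Part.map_some]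
      cases E (Nat.pair (Nat.pair x n) (Encodable.encode (initSeg A n.unpair.2))) <;> rfl
    simp only [hrf]
    simp only [turingFunctional, Nat.rfindOpt]
    simp [Seq.seq, E, Part.bind_map]

/-- The Turing jump `A' = {e : Φ_e^A(e) is defined}`. -/
def turingJump (A : Set ℕ) : Set ℕ := {e | (turingFunctional e A e).Dom}

/-- A Turing ideal: closed downward under Turing reducibility and closed under joins. -/
structure IsTuringIdeal (U : Set (Set ℕ)) : Prop where
  downward : ∀ A B : Set ℕ, A ∈ U → TuringLE B A → B ∈ U
  join : ∀ A B : Set ℕ, A ∈ U → B ∈ U → turingJoin A B ∈ U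

/-- `U` is jump-cofinal in the Turing degrees: every set is computable from the jump of some
element of `U`. -/
def JumpCofinal (U : Set (Set ℕ)) : Prop :=
  ∀ X : Set ℕ, ∃ C ∈ U, TuringLE X (turingJump C)

/-- Every countable subset of `U` has an upper bound in `U` with respect to Turing
reducibility. -/
def CountableSubsetsBounded (U : Set (Set ℕ)) : Prop :=
  ∀ V : Set (Set ℕ), V ⊆ U → V.Countable → ∃ C ∈ U, ∀ A ∈ V, TuringLE A C

end

/-! The space of coarse classes is complete, so closed and complete agree for its subspaces. A fast
Cauchy sequence `B` converges to `mix B`, which on the dyadic block `[2^k, 2^(k+1))` copies one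
member of the sequence. A finite test on initial segments chooses this member, so `mix B` is
computable from any oracle that computes the sequence uniformly (`turingLE_mix`).

Suppose the two conditions hold and `X` is approximated within `2⁻ⁿ` by `A n ∈ U`. A bound `C ∈ U`
computes each `A n`, but perhaps not uniformly. Jump-cofinality gives `D ∈ U` whose jump computes a
sequence of indices, and by the limit lemma `D` computes guesses converging to these indices.
Evaluating at `x` with a guess from a stage at least `x` goes wrong for only finitely many `x`. So
finite modifications `B n` of the `A n` are uniformly computable in `C ⊕ D`. Finite changes are
invisible to coarse similarity, hence `mix B` lies in `U` and represents the class of `X`.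

Conversely, let the subspace be closed and let `Y n ∈ U`. Put `Y n` into the column `x ≡ 2^n mod
2^(n+1)`, which has positive density, spreading the bit `k ∈ Y n` over the `k`-th dyadic block.
Truncations to finitely many columns lie in `U` and converge to the full code, so some `D ∈ U` is
coarsely similar to it. Majority vote in `D` recovers each `Y n` up to finitely many errors,
uniformly in `n` (`IsTuringIdeal.exists_uniform_of_isClosed`). Enumerating a countable `V` as `Y`
gives a bound. Taking `Y n` to be everything or nothing according to whether `n ∈ X` makes `X` a
limit of a `D`-computable function, so `X` is computable from the jump of `D`. -/

theorem Nat.RecursiveIn.prec_bind {O : Set (ℕ →. ℕ)} {f g h : ℕ →. ℕ} (hf : Nat.RecursiveIn O f)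
    (hg : Nat.RecursiveIn O g) (hh : Nat.RecursiveIn O h) :
    Nat.RecursiveIn O fun a => (f a).bind fun n => n.rec (g a)
      fun y IH => IH.bind fun i => h (Nat.pair a (Nat.pair y i)) :=
  ((Nat.RecursiveIn.prec hg hh).comp
    (Nat.RecursiveIn.pair (Nat.Partrec.some.recursiveIn) hf)).of_eq fun a =>
    Part.ext fun s => by simp [Seq.seq]

/-! ### Closure properties of oracle computability -/

section OracleComputability

variable {α β γ σ : Type*} [Primcodable α] [Primcodable β] [Primcodable γ] [Primcodable σ]
variable {O : Set (ℕ →. ℕ)}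

open Encodable

theorem RecursiveIn.comp_computableIn {f : β →. σ} {g : α → β} (hf : RecursiveIn O f)
    (hg : ComputableIn O g) : RecursiveIn O fun a => f (g a) :=
  (Nat.RecursiveIn.comp hf hg).of_eq fun n => by
    simp only [Part.map_some, Part.bind_eq_bind]
    rcases e : decode (α := α) n with - | a <;> simp [encodek]

namespace ComputableIn

theorem of_eq {f g : α → σ} (hf : ComputableIn O f) (H : ∀ a, f a = g a) : ComputableIn O g :=
  (funext H : f = g) ▸ hf

theorem comp {f : β → σ} {g : α → β} (hf : ComputableIn O f) (hg : ComputableIn O g) :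
    ComputableIn O fun a => f (g a) :=
  RecursiveIn.comp_computableIn (f := fun b => Part.some (f b)) hf hg

theorem pair {f : α → β} {g : α → γ} (hf : ComputableIn O f) (hg : ComputableIn O g) :
    ComputableIn O fun a => (f a, g a) :=
  (Nat.RecursiveIn.pair hf hg).of_eq fun n => by cases decode (α := α) n <;> simp [Seq.seq]

theorem comp₂ {f : β → γ → σ} {g : α → β} {h : α → γ} (hf : ComputableIn₂ O f)
    (hg : ComputableIn O g) (hh : ComputableIn O h) : ComputableIn O fun a => f (g a) (h a) :=
  comp (f := fun p : β × γ => f p.1 p.2) hf (hg.pair hh)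

theorem nat_rec {f : α → ℕ} {g : α → σ} {h : α → ℕ × σ → σ} (hf : ComputableIn O f)
    (hg : ComputableIn O g) (hh : ComputableIn₂ O h) :
    ComputableIn O fun a =>
      Nat.rec (motive := fun _ => σ) (g a) (fun y IH => h a (y, IH)) (f a) :=
  (Nat.RecursiveIn.prec_bind hf hg hh).of_eq fun n => by
    rcases e : decode (α := α) n with - | a
    · simp
    · simp only [Part.coe_some, Part.bind_some, Part.map_some, encode_nat]
      induction f a <;> simp_all

theorem cond {c : α → Bool} {f g : α → σ} (hc : ComputableIn O c) (hf : ComputableIn O f)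
    (hg : ComputableIn O g) : ComputableIn O fun a => bif c a then f a else g a :=
  (nat_rec (f := fun a => encode (c a)) (h := fun a _ => f a)
    (Primrec.encode.computableIn.comp hc) hg (hf.comp .fst)).of_eq fun a => by
      cases c a <;> rfl

/-- Counting makes bounded quantifiers and densities on finite intervals computable. -/
theorem count {p : α → ℕ → Bool} {h : α → ℕ} (hp : ComputableIn₂ O p) (hh : ComputableIn O h) :
    ComputableIn O fun a => Nat.count (fun n => p a n = true) (h a) := by
  refine (nat_rec (g := fun _ => 0) (h := fun a q => q.2 + bif p a q.1 then 1 else 0) hh (.const 0)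
    ?_).of_eq fun a => ?_
  · exact comp₂ (f := fun a b : ℕ => a + b) Primrec.nat_add.computableIn₂
      (ComputableIn.snd.comp .snd)
      (cond (comp₂ hp .fst (ComputableIn.fst.comp .snd)) (.const 1) (.const 0))
  · induction h a with
    | zero => simp
    | succ n ih =>
      simp only [Nat.count_succ, Bool.cond_eq_ite] at ih ⊢
      rw [ih]

theorem not {p : α → Bool} (hp : ComputableIn O p) : ComputableIn O fun a => !(p a) :=
  comp (f := Bool.not) Primrec.not.computableIn hp

theorem and {p q : α → Bool} (hp : ComputableIn O p) (hq : ComputableIn O q) :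
    ComputableIn O fun a => p a && q a :=
  comp₂ Primrec.and.computableIn₂ hp hq

theorem or {p q : α → Bool} (hp : ComputableIn O p) (hq : ComputableIn O q) :
    ComputableIn O fun a => p a || q a :=
  comp₂ Primrec.or.computableIn₂ hp hq

theorem decide_lt {f g : α → ℕ} (hf : ComputableIn O f) (hg : ComputableIn O g) :
    ComputableIn O fun a => decide (f a < g a) :=
  comp₂ (f := fun a b : ℕ => decide (a < b)) Primrec.nat_lt.decide.computableIn hf hg

theorem decide_le {f g : α → ℕ} (hf : ComputableIn O f) (hg : ComputableIn O g) :
    ComputableIn O fun a => decide (f a ≤ g a) :=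
  comp₂ (f := fun a b : ℕ => decide (a ≤ b)) Primrec.nat_le.decide.computableIn hf hg

theorem decide_eq [DecidableEq σ] {f g : α → σ} (hf : ComputableIn O f) (hg : ComputableIn O g) :
    ComputableIn O fun a => decide (f a = g a) :=
  comp₂ (f := fun a b : σ => decide (a = b)) Primrec.eq.decide.computableIn hf hg

theorem mul {f g : α → ℕ} (hf : ComputableIn O f) (hg : ComputableIn O g) :
    ComputableIn O fun a => f a * g a :=
  comp₂ (f := fun a b : ℕ => a * b) Primrec.nat_mul.computableIn₂ hf hg

theorem add {f g : α → ℕ} (hf : ComputableIn O f) (hg : ComputableIn O g) :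
    ComputableIn O fun a => f a + g a :=
  comp₂ (f := fun a b : ℕ => a + b) Primrec.nat_add.computableIn₂ hf hg

theorem mod {f g : α → ℕ} (hf : ComputableIn O f) (hg : ComputableIn O g) :
    ComputableIn O fun a => f a % g a :=
  comp₂ (f := fun a b : ℕ => a % b) Primrec.nat_mod.computableIn₂ hf hg

theorem two_pow {f : α → ℕ} (hf : ComputableIn O f) : ComputableIn O fun a => 2 ^ f a :=
  (nat_rec (g := fun _ => 1) (h := fun _ q => q.2 * 2) hf (.const 1)
    (mul (ComputableIn.snd.comp .snd) (.const 2))).of_eq fun a => by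
      induction f a with
      | zero => rfl
      | succ n ih => simp only [ih, pow_succ]

/-- Bounded existential quantification over a computable predicate. -/
theorem exists_lt {p : α → ℕ → Bool} {h : α → ℕ} (hp : ComputableIn₂ O p)
    (hh : ComputableIn O h) : ComputableIn O fun a => decide (∃ n < h a, p a n = true) :=
  (decide_lt (.const 0) (count hp hh)).of_eq fun a => by
    rw [decide_eq_decide, Nat.pos_iff_ne_zero, Ne, Nat.count_iff_forall_not]
    push Not
    rfl

end ComputableIn

theorem RecursiveIn.rfind {p : α → ℕ → Bool} (hp : ComputableIn₂ O p) :
    RecursiveIn O fun a => Nat.rfind fun n => Part.some (p a n) := by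
  -- `Nat.RecursiveIn.rfind` searches for the value `0`, so truth is coded by `0`.
  have h : ComputableIn O fun q : α × ℕ => bif p q.1 q.2 then 0 else 1 :=
    ComputableIn.cond hp (.const 0) (.const 1)
  refine (Nat.RecursiveIn.rfind h).of_eq fun n => ?_
  rcases e : decode (α := α) n with - | a
  · simpa [e] using Nat.rfind_zero_none (fun _ => Part.none) rfl
  · simp only [Nat.unpair_pair, decode_prod_val, e, Option.map_some, decode_nat, Part.coe_some,
      Part.bind_some, Part.map_some, encode_nat, Part.map_eq_map, Option.bind_some]
    rw [Part.map_id' (by simp)]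
    congr 1
    funext n
    cases p a n <;> simp

/-- Unbounded search for a witness that is known to exist. -/
theorem ComputableIn.find {p : α → ℕ → Bool} (hp : ComputableIn₂ O p)
    (hex : ∀ a, ∃ n, p a n = true) : ComputableIn O fun a => Nat.find (hex a) :=
  (RecursiveIn.rfind hp).of_eq fun a => Part.eq_some_iff.2 <| Nat.mem_rfind.2
    ⟨by simpa using Nat.find_spec (hex a), fun {m} hm => by simpa using Nat.find_min (hex a) hm⟩

theorem ComputableIn.trans {f : α → σ} {O' : Set (ℕ →. ℕ)} (hf : ComputableIn O f)
    (h : ∀ g ∈ O, RecursiveIn O' g) : ComputableIn O' f :=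
  RecursiveIn.subst hf h

end OracleComputability

/-! ### Sets as oracles -/

noncomputable section

open Classical in
/-- The Boolean characteristic function of a set. -/
def chi (A : Set ℕ) (n : ℕ) : Bool := decide (n ∈ A)

end

@[simp] theorem chi_eq_true {A : Set ℕ} {n : ℕ} : chi A n = true ↔ n ∈ A := by simp [chi]

@[simp] theorem chi_eq_false {A : Set ℕ} {n : ℕ} : chi A n = false ↔ n ∉ A := by simp [chi]

theorem initSeg_eq_map_chi (A : Set ℕ) (s : ℕ) : initSeg A s = (List.range s).map (chi A) := rfl

/-- This passes from the `0`/`1`-valued `charFn` to Boolean functions, so that reductions can be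
assembled from the closure properties above. -/
theorem turingLE_iff {A : Set ℕ} {O : ℕ →. ℕ} :
    TuringReducible (charFn A) O ↔ ComputableIn {O} (chi A) := by
  constructor
  · intro h
    have h1 : ComputableIn {O} fun n => bif chi A n then 1 else 0 := by
      refine RecursiveIn.of_eq h fun n => ?_
      by_cases hn : n ∈ A <;> simp [charFn, chi, hn]
    refine (ComputableIn.decide_eq h1 (.const 1)).of_eq fun n => ?_
    cases chi A n <;> rfl
  · intro h
    refine RecursiveIn.of_eq (ComputableIn.cond h (.const 1) (.const 0)) fun n => ?_
    by_cases hn : n ∈ A <;> simp [charFn, chi, hn]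

/-- `f` is computable in the set `C`. -/
abbrev SetComputable {α σ : Type*} [Primcodable α] [Primcodable σ] (C : Set ℕ) (f : α → σ) : Prop :=
  ComputableIn {charFn C} f

theorem TuringLE.iff {A C : Set ℕ} : TuringLE A C ↔ SetComputable C (chi A) := turingLE_iff

theorem setComputable_chi (C : Set ℕ) : SetComputable C (chi C) :=
  TuringLE.iff.1 (TuringReducible.refl _)

theorem SetComputable.mono {α σ : Type*} [Primcodable α] [Primcodable σ] {C D : Set ℕ} {f : α → σ}
    (hf : SetComputable C f) (h : TuringLE C D) : SetComputable D f :=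
  ComputableIn.trans hf (by rintro g rfl; exact h)

theorem setComputable_initSeg (C : Set ℕ) : SetComputable C (initSeg C) := by
  refine (ComputableIn.nat_rec (f := id) (g := fun _ : ℕ => ([] : List Bool))
    (h := fun _ q => q.2 ++ [chi C q.1]) .id (.const _) ?_).of_eq fun n => ?_
  · exact ComputableIn.comp₂ (f := fun (l : List Bool) (b : Bool) => l ++ [b])
      Primrec.list_concat.computableIn₂ (ComputableIn.snd.comp .snd)
      ((setComputable_chi C).comp (ComputableIn.fst.comp .snd))
  · induction n with
    | zero => rfl
    | succ n ih =>
      simp only [id_eq] at ih ⊢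
      rw [ih, initSeg_eq_map_chi, initSeg_eq_map_chi, List.range_succ]
      simp

theorem turingLE_join_left (A B : Set ℕ) : TuringLE A (turingJoin A B) :=
  TuringLE.iff.2 <| ((setComputable_chi _).comp Primrec.nat_double.computableIn).of_eq fun n => by
    rw [Bool.eq_iff_iff, chi_eq_true, chi_eq_true]
    constructor
    · rintro (⟨m, hm, h⟩ | ⟨m, hm, h⟩)
      · obtain rfl : m = n := by simpa using h
        exact hm
      · simp only at h; omega
    · exact fun h => Or.inl ⟨n, h, rfl⟩

theorem turingLE_join_right (A B : Set ℕ) : TuringLE B (turingJoin A B) :=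
  TuringLE.iff.2 <| ((setComputable_chi _).comp Primrec.nat_double_succ.computableIn).of_eq
    fun n => by
      rw [Bool.eq_iff_iff, chi_eq_true, chi_eq_true]
      constructor
      · rintro (⟨m, hm, h⟩ | ⟨m, hm, h⟩)
        · simp only at h; omega
        · obtain rfl : m = n := by simpa using h
          exact hm
      · exact fun h => Or.inr ⟨n, h, rfl⟩

/-! ### Computations in stages and the limit lemma -/

open Nat.Partrec (Code)

/-- Bounded and unbounded search both return the value at the first hit; in this form `stageValue`
can be compared with `turingFunctional`. -/
theorem List.findSome?_range_eq_some_iff {α : Type*} (f : ℕ → Option α) (u : ℕ) (y : α) :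
    (List.range u).findSome? f = some y ↔ ∃ t < u, f t = some y ∧ ∀ s < t, f s = none := by
  induction u with
  | zero => simp
  | succ u ih =>
    rw [List.range_succ, List.findSome?_append]
    rcases h : (List.range u).findSome? f with - | z
    · rw [List.findSome?_eq_none_iff] at h
      simp only [List.mem_range] at h
      constructor
      · intro hy
        refine ⟨u, u.lt_succ_self, ?_, h⟩
        simpa using hy
      · rintro ⟨t, ht, hy, -⟩
        rcases Nat.lt_succ_iff_lt_or_eq.1 ht with ht | rfl
        · simp [h t ht] at hy
        · simpa using hy
    · rw [h] at ih
      simp only [Option.some_or]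
      rw [ih]
      constructor
      · rintro ⟨t, ht, hy⟩
        exact ⟨t, ht.trans u.lt_succ_self, hy⟩
      · rintro ⟨t, ht, hy, hs⟩
        rcases Nat.lt_succ_iff_lt_or_eq.1 ht with ht | rfl
        · exact ⟨t, ht, hy, hs⟩
        · have : (List.range t).findSome? f = none := by
            rw [List.findSome?_eq_none_iff]; simpa using hs
          simp [this] at h

theorem Nat.mem_rfindOpt_iff {α : Type*} (f : ℕ → Option α) (y : α) :
    y ∈ Nat.rfindOpt f ↔ ∃ t, f t = some y ∧ ∀ s < t, f s = none := by
  simp only [Nat.rfindOpt, Part.mem_bind_iff]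
  constructor
  · rintro ⟨t, h1, h3⟩
    exact ⟨t, by simpa using h3, fun s hs => by simpa using (Nat.mem_rfind.1 h1).2 hs⟩
  · rintro ⟨t, h1, h2⟩
    exact ⟨t, Nat.mem_rfind.2 ⟨by simp [h1], fun {s} hs => by simp [h2 s hs]⟩, by simp [h1]⟩

noncomputable section

/-- The result of running the `e`-th oracle machine on input `x` for `u` stages, with the finite
string `σ` as its oracle. -/
def stageValue (e x u : ℕ) (σ : List Bool) : Option ℕ :=
  (List.range u).findSome? fun t =>
    Code.evaln t.unpair.1 (Denumerable.ofNat Code e)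
      (Nat.pair x (Encodable.encode (σ.take t.unpair.2)))

end

theorem primrec_stageValue :
    Primrec fun p : ((ℕ × ℕ) × ℕ) × List Bool => stageValue p.1.1.1 p.1.1.2 p.1.2 p.2 := by
  have h : Primrec₂ fun (p : ((ℕ × ℕ) × ℕ) × List Bool) (t : ℕ) =>
      Code.evaln t.unpair.1 (Denumerable.ofNat Code p.1.1.1)
        (Nat.pair p.1.1.2 (Encodable.encode (p.2.take t.unpair.2))) := by
    refine Code.primrec_evaln.comp (Primrec.pair (Primrec.pair ?_ ?_) ?_)
    · exact Primrec.fst.comp (Primrec.unpair.comp Primrec.snd)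
    · exact (Primrec.ofNat Code).comp
        (Primrec.fst.comp (Primrec.fst.comp (Primrec.fst.comp Primrec.fst)))
    · refine Primrec₂.natPair.comp
        (Primrec.snd.comp (Primrec.fst.comp (Primrec.fst.comp Primrec.fst))) ?_
      exact Primrec.encode.comp (Primrec.list_take.comp
        (Primrec.snd.comp (Primrec.unpair.comp Primrec.snd)) (Primrec.snd.comp Primrec.fst))
  refine (Primrec.list_head?.comp (Primrec.listFilterMap
    (Primrec.list_range.comp (Primrec.snd.comp Primrec.fst)) h)).of_eq fun p => ?_
  rw [List.head?_filterMap]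
  rfl

theorem ComputableIn.stageValue {α : Type*} [Primcodable α] {O : Set (ℕ →. ℕ)} {e x u : α → ℕ}
    {τ : α → List Bool} (he : ComputableIn O e) (hx : ComputableIn O x) (hu : ComputableIn O u)
    (hτ : ComputableIn O τ) : ComputableIn O fun a => _root_.stageValue (e a) (x a) (u a) (τ a) :=
  comp primrec_stageValue.computableIn (((he.pair hx).pair hu).pair hτ)

theorem take_initSeg (A : Set ℕ) {s u : ℕ} (h : s ≤ u) :
    (initSeg A u).take s = initSeg A s := by
  rw [initSeg_eq_map_chi, initSeg_eq_map_chi, ← List.map_take, List.take_range, min_eq_left h]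

/-- Step `t < u` of the search reads a prefix of length `t.unpair.2 ≤ t`, on which the string of
length `u` is already correct. -/
theorem mem_turingFunctional_of_stageValue {e x u y : ℕ} {A : Set ℕ}
    (h : stageValue e x u (initSeg A u) = some y) : y ∈ turingFunctional e A x := by
  obtain ⟨t, ht, hy, hs⟩ := (List.findSome?_range_eq_some_iff _ _ _).1 h
  have key : ∀ t < u, (initSeg A u).take t.unpair.2 = initSeg A t.unpair.2 := fun t ht =>
    take_initSeg A ((Nat.unpair_right_le t).trans ht.le)
  refine (Nat.mem_rfindOpt_iff _ _).2 ⟨t, ?_, fun s hst => ?_⟩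
  · rw [← key t ht]; exact hy
  · rw [← key s (hst.trans ht)]; exact hs s hst

/-- Along oracle strings that converge to `A`, the stages converge to the computation from `A`. -/
theorem eventually_stageValue_eq {e x y : ℕ} {A : Set ℕ} {τ : ℕ → List Bool}
    (hτ : ∀ s, ∀ᶠ u in atTop, (τ u).take s = initSeg A s) (h : y ∈ turingFunctional e A x) :
    ∀ᶠ u in atTop, stageValue e x u (τ u) = some y := by
  obtain ⟨t, ht, hs⟩ := (Nat.mem_rfindOpt_iff _ _).1 h
  have hall : ∀ᶠ u in atTop, ∀ s ∈ Finset.range (t + 1), (τ u).take s = initSeg A s :=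
    (Finset.eventually_all _).2 fun s _ => hτ s
  filter_upwards [hall, eventually_gt_atTop t] with u hu htu
  refine (List.findSome?_range_eq_some_iff _ _ _).2 ⟨t, htu, ?_, fun s hst => ?_⟩
  · rw [hu _ (Finset.mem_range.2 (Nat.lt_succ_of_le (Nat.unpair_right_le t)))]
    exact ht
  · rw [hu _ (Finset.mem_range.2 (Nat.lt_succ_of_le ((Nat.unpair_right_le s).trans hst.le)))]
    exact hs s hst

theorem eventually_stageValue_initSeg {e x y : ℕ} {A : Set ℕ} (h : y ∈ turingFunctional e A x) :
    ∀ᶠ u in atTop, stageValue e x u (initSeg A u) = some y :=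
  eventually_stageValue_eq (fun s => (eventually_ge_atTop s).mono fun _ hu => take_initSeg A hu) h

theorem List.take_map_range_eventually {A : Set ℕ} {p : ℕ → ℕ → Bool}
    (h : ∀ i, ∀ᶠ u in atTop, p u i = chi A i) (s : ℕ) :
    ∀ᶠ u in atTop, ((List.range u).map (p u)).take s = initSeg A s := by
  have hall : ∀ᶠ u in atTop, ∀ i ∈ Finset.range s, p u i = chi A i :=
    (Finset.eventually_all _).2 fun i _ => h i
  filter_upwards [hall, eventually_ge_atTop s] with u hu hsu
  rw [← List.map_take, List.take_range, min_eq_left hsu, initSeg_eq_map_chi]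
  exact List.map_congr_left fun i hi => hu i (Finset.mem_range.2 (List.mem_range.1 hi))

/-- The jump is approximated from below: a stage that converges shows a genuine computation, and a
genuine computation shows at all late stages. -/
theorem eventually_stageValue_turingJump (A : Set ℕ) (i : ℕ) :
    ∀ᶠ u in atTop, (stageValue i i u (initSeg A u)).isSome = chi (turingJump A) i := by
  by_cases h : (turingFunctional i A i).Dom
  · filter_upwards [eventually_stageValue_initSeg (Part.get_mem h)] with u hu
    rw [hu, Option.isSome_some]
    exact (chi_eq_true.2 (show i ∈ turingJump A from h)).symm
  · refine Eventually.of_forall fun u => ?_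
    rw [chi_eq_false.2 (show i ∉ turingJump A from h), Option.isSome_eq_false_iff,
      Option.isNone_iff_eq_none, Option.eq_none_iff_forall_ne_some]
    exact fun y hy => h (Part.dom_iff_mem.2 ⟨y, mem_turingFunctional_of_stageValue hy⟩)

/-- One direction of the limit lemma: a function computable in the jump of `D` is the limit of a
`D`-computable function. -/
theorem SetComputable.exists_limit_of_turingJump {D : Set ℕ} {f : ℕ → ℕ}
    (hf : SetComputable (turingJump D) f) :
    ∃ g : ℕ × ℕ → ℕ, SetComputable D g ∧ ∀ x, ∀ᶠ u in atTop, g (x, u) = f x := by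
  obtain ⟨e, he⟩ := (charFn_recursiveIn_iff _ _).1 hf
  let p : ℕ × List Bool → ℕ → Bool := fun q i => (stageValue i i q.1 q.2).isSome
  have hp : Primrec₂ p := Primrec.option_isSome.comp (primrec_stageValue.comp
    (Primrec.pair (Primrec.pair (Primrec.pair Primrec.snd Primrec.snd)
      (Primrec.fst.comp Primrec.fst)) (Primrec.snd.comp Primrec.fst)))
  have hτ : Primrec fun q : ℕ × List Bool => (List.range q.1).map (p q) :=
    Primrec.list_map (Primrec.list_range.comp Primrec.fst) hp
  -- Stage `u` runs the machine on the stage-`u` guess at the jump. The default `0` is used only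
  -- when this run has not converged, which does not matter in the limit.
  refine ⟨fun q => (stageValue e q.1 q.2
    ((List.range q.2).map (p (q.2, initSeg D q.2)))).getD 0, ?_, fun x => ?_⟩
  · refine ComputableIn.comp₂ (f := fun (o : Option ℕ) (d : ℕ) => o.getD d)
      (Primrec.option_getD.computableIn₂) (ComputableIn.stageValue (.const e) .fst .snd ?_)
      (.const 0)
    exact ComputableIn.comp hτ.computableIn
      (ComputableIn.pair .snd ((setComputable_initSeg D).comp .snd))
  · have hx : f x ∈ turingFunctional e (turingJump D) x := by rw [he]; exact Part.mem_some _
    filter_upwards [eventually_stageValue_eq (List.take_map_range_eventually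
      (eventually_stageValue_turingJump D)) hx] with u hu
    simp only [p, hu, Option.getD_some]

/-! ### Questions decided by the jump -/

theorem turingFunctional_dom_iff (e : ℕ) (A : Set ℕ) (x : ℕ) :
    (turingFunctional e A x).Dom ↔
      ∃ s, (Code.eval (Denumerable.ofNat Code e)
        (Nat.pair x (Encodable.encode (initSeg A s)))).Dom := by
  rw [turingFunctional, Nat.rfindOpt_dom]
  constructor
  · rintro ⟨t, y, hy⟩
    exact ⟨t.unpair.2, Part.dom_iff_mem.2 ⟨y, Code.evaln_sound hy⟩⟩
  · rintro ⟨s, hs⟩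
    obtain ⟨k, hk⟩ := Code.evaln_complete.1 (Part.get_mem hs)
    exact ⟨Nat.pair k s, _, by simpa only [Nat.unpair_pair] using hk⟩

/-- The domain of an `A`-computable partial function is many-one reducible to the jump of `A`. -/
theorem RecursiveIn.exists_reduction_turingJump {A : Set ℕ} {f : ℕ →. ℕ}
    (hf : RecursiveIn {charFn A} f) :
    ∃ q : ℕ → ℕ, Computable q ∧ ∀ m, q m ∈ turingJump A ↔ (f m).Dom := by
  obtain ⟨e, rfl⟩ := (charFn_recursiveIn_iff _ _).1 hf
  -- This code sends `(m, (z, τ))` to the `e`-th machine on `(m, τ)`. With `m` fixed by `curry`, it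
  -- ignores its own input `z`, so its diagonal computation halts exactly when `f m` does.
  let c : Code := Code.comp (Denumerable.ofNat Code e)
    (Code.pair Code.left (Code.comp Code.right Code.right))
  have hc : ∀ m z τ, Code.eval (Code.curry c m) (Nat.pair z τ)
      = Code.eval (Denumerable.ofNat Code e) (Nat.pair m τ) := by
    intro m z τ
    have hbind : ∀ (a : ℕ) (g : ℕ →. ℕ), (Part.some a >>= g) = g a := fun a g => Part.bind_some a g
    simp [c, Code.eval_curry, Code.eval, Seq.seq, hbind]
  refine ⟨fun m => Encodable.encode (Code.curry c m),
    (Primrec.encode.comp (Code.primrec₂_curry.comp (Primrec.const c) Primrec.id)).to_comp,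
    fun m => ?_⟩
  change (turingFunctional _ A _).Dom ↔ _
  rw [turingFunctional_dom_iff, turingFunctional_dom_iff, Denumerable.ofNat_encode]
  simp only [hc]

/-- A `Σ₁`-question about `A` is answered by the jump of `A`. -/
theorem ComputableIn₂.exists_setComputable_turingJump {A : Set ℕ} {p : ℕ → ℕ → Bool}
    (hp : ComputableIn₂ {charFn A} p) :
    ∃ b : ℕ → Bool, SetComputable (turingJump A) b ∧ ∀ m, b m = true ↔ ∃ n, p m n = true := by
  obtain ⟨q, hq, hqm⟩ := (RecursiveIn.rfind hp).exists_reduction_turingJump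
  refine ⟨fun m => chi (turingJump A) (q m), (setComputable_chi _).comp hq.computableIn,
    fun m => ?_⟩
  rw [chi_eq_true, hqm]
  refine Nat.rfind_dom.trans ?_
  simp

theorem turingLE_turingJump (A : Set ℕ) : TuringLE A (turingJump A) := by
  obtain ⟨b, hb, hbm⟩ := ComputableIn₂.exists_setComputable_turingJump
    (p := fun m _ => chi A m) ((setComputable_chi A).comp .fst)
  refine TuringLE.iff.2 (hb.of_eq fun m => ?_)
  rw [Bool.eq_iff_iff, hbm]
  simp

/-- The other direction of the limit lemma: the limit of a `D`-computable function is computable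
in the jump of `D`. -/
theorem SetComputable.turingJump_of_limit {D X : Set ℕ} {g : ℕ × ℕ → Bool}
    (hg : SetComputable D g) (hlim : ∀ n, ∀ᶠ k in atTop, g (n, k) = chi X n) :
    TuringLE X (turingJump D) := by
  have hunp : ComputableIn {charFn D} fun q : ℕ × ℕ => q.1.unpair :=
    Primrec.unpair.computableIn.comp .fst
  -- The `Σ₁`-question is whether the guess for `n` made at stage `t` differs from a later one. The
  -- jump can thus search for the first stage after which the guess is constant, and read the limit
  -- there.
  obtain ⟨b, hb, hbm⟩ := ComputableIn₂.exists_setComputable_turingJump (A := D)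
    (p := fun m s => decide (m.unpair.2 ≤ s) && !decide (g (m.unpair.1, s) = g m.unpair))
    (ComputableIn.and (ComputableIn.decide_le (ComputableIn.snd.comp hunp) .snd)
      (ComputableIn.not (ComputableIn.decide_eq
        (hg.comp ((ComputableIn.fst.comp hunp).pair .snd)) (hg.comp hunp))))
  have hb' : ∀ n t, (!(b (Nat.pair n t))) = true ↔ ∀ s ≥ t, g (n, s) = g (n, t) := by
    intro n t
    rw [Bool.not_eq_true', ← Bool.not_eq_true, hbm]
    simp only [Nat.unpair_pair]
    simp
  have hex : ∀ n, ∃ t, (!(b (Nat.pair n t))) = true := by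
    intro n
    obtain ⟨t, ht⟩ := eventually_atTop.1 (hlim n)
    exact ⟨t, (hb' n t).2 fun s hs => (ht s hs).trans (ht t le_rfl).symm⟩
  have hfind := ComputableIn.find (O := {charFn (turingJump D)})
    (p := fun n t => !(b (Nat.pair n t)))
    (ComputableIn.not (hb.comp Primrec₂.natPair.computableIn)) hex
  refine TuringLE.iff.2 (((hg.mono (turingLE_turingJump D)).comp
    (ComputableIn.id.pair hfind)).of_eq fun n => ?_)
  have h1 := (hb' n _).1 (Nat.find_spec (hex n))
  obtain ⟨s, hs1, hs2⟩ := ((hlim n).and (eventually_ge_atTop (Nat.find (hex n)))).exists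
  exact (h1 s hs2).symm.trans hs1

/-! ### Estimates of upper density -/

theorem ncard_inter_Iio_eq_count {A : Set ℕ} {p : ℕ → Bool} (h : ∀ n, p n = true ↔ n ∈ A) (n : ℕ) :
    (A ∩ Set.Iio n).ncard = Nat.count (fun y => p y = true) n := by
  rw [Nat.count_eq_card_filter_range, ← Set.ncard_coe_finset]
  congr 1
  ext y
  simp [h, and_comm]

theorem densityAt_mono {A B : Set ℕ} (h : A ⊆ B) (n : ℕ) : densityAt A n ≤ densityAt B n := by
  unfold densityAt
  gcongr
  exact (Set.finite_Iio n).inter_of_right _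

theorem upperDensity_mono {A B : Set ℕ} (h : A ⊆ B) : upperDensity A ≤ upperDensity B :=
  limsup_le_limsup (Eventually.of_forall (densityAt_mono h))
    (isBoundedUnder_ge_densityAt _).isCoboundedUnder_le (isBoundedUnder_densityAt _)

theorem upperDensity_le_of_densityAt_le {A : Set ℕ} {c d : ℝ}
    (h : ∀ᶠ n in atTop, densityAt A n ≤ c / n + d) : upperDensity A ≤ d := by
  have ht : Tendsto (fun n : ℕ => c / (n : ℝ) + d) atTop (𝓝 d) := by
    simpa using (tendsto_const_div_atTop_nhds_zero_nat c).add_const d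
  rw [← ht.limsup_eq]
  exact limsup_le_limsup h (isBoundedUnder_ge_densityAt _).isCoboundedUnder_le
    ht.isBoundedUnder_le

theorem eventually_densityAt_lt {A : Set ℕ} {ε : ℝ} (h : upperDensity A < ε) :
    ∀ᶠ n in atTop, densityAt A n < ε :=
  eventually_lt_of_limsup_lt h (isBoundedUnder_densityAt _)

theorem eventually_ncard_lt_two_pow {A : Set ℕ} {ε : ℝ} (h : upperDensity A < ε) :
    ∀ᶠ k : ℕ in atTop, ((A ∩ Set.Iio (2 ^ (k + 1))).ncard : ℝ) < ε * 2 ^ (k + 1) := by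
  have ht : Tendsto (fun k : ℕ => 2 ^ (k + 1)) atTop atTop :=
    (tendsto_pow_atTop_atTop_of_one_lt (by norm_num : 1 < 2)).comp (tendsto_add_atTop_nat 1)
  filter_upwards [ht.eventually (eventually_densityAt_lt h)] with k hk
  rw [densityAt, div_lt_iff₀ (by positivity)] at hk
  exact_mod_cast hk

/-- Upper density is controlled by the densities on the dyadic blocks `[2^k, 2^(k+1))`. -/
theorem upperDensity_le_of_blocks {Z : Set ℕ} {ε : ℝ} (hε : 0 ≤ ε)
    (h : ∀ᶠ k : ℕ in atTop,
      ((Z ∩ Set.Ico (2 ^ k) (2 ^ (k + 1))).ncard : ℝ) ≤ ε * 2 ^ (k + 1)) :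
    upperDensity Z ≤ 4 * ε := by
  obtain ⟨k₀, hk₀⟩ := eventually_atTop.1 h
  have hfin : ∀ n, (Z ∩ Set.Iio n).Finite := fun n => (Set.finite_Iio n).inter_of_right _
  set c : ℝ := ((Z ∩ Set.Iio (2 ^ k₀)).ncard : ℝ) with hc
  -- The blocks below `2^k₀` are absorbed in `c`; for the others, the sum of `2^(k+1)` over `k₀ ≤ k
  -- < K` is less than `2^(K+1)`.
  have key : ∀ K ≥ k₀, ((Z ∩ Set.Iio (2 ^ K)).ncard : ℝ) ≤ c + ε * 2 ^ (K + 1) := by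
    intro K hK
    induction K, hK using Nat.le_induction with
    | base => exact le_add_of_nonneg_right (by positivity)
    | succ K hK ih =>
      have hsub : Z ∩ Set.Iio (2 ^ (K + 1)) ⊆
          (Z ∩ Set.Iio (2 ^ K)) ∪ (Z ∩ Set.Ico (2 ^ K) (2 ^ (K + 1))) := by
        rintro x ⟨hx, hlt⟩
        rcases lt_or_ge x (2 ^ K) with h1 | h1
        · exact Or.inl ⟨hx, h1⟩
        · exact Or.inr ⟨hx, h1, hlt⟩
      have h1 := (Set.ncard_le_ncard hsub ((hfin _).union
        ((Set.finite_Ico _ _).inter_of_right _))).trans (Set.ncard_union_le _ _)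
      have h2 : ((Z ∩ Set.Iio (2 ^ (K + 1))).ncard : ℝ) ≤ (Z ∩ Set.Iio (2 ^ K)).ncard +
        (Z ∩ Set.Ico (2 ^ K) (2 ^ (K + 1))).ncard := by exact_mod_cast h1
      have h3 := hk₀ K hK
      rw [pow_succ 2 (K + 1)]
      linarith
  refine upperDensity_le_of_densityAt_le (c := c) ?_
  filter_upwards [eventually_ge_atTop (2 ^ k₀)] with N hN
  have hN0 : 0 < N := lt_of_lt_of_le (by positivity) hN
  set K := Nat.log 2 N with hK
  have h1 : 2 ^ K ≤ N := Nat.pow_log_le_self 2 hN0.ne'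
  have h2 : N < 2 ^ (K + 1) := Nat.lt_pow_succ_log_self (by norm_num) N
  have h3 : k₀ ≤ K := (Nat.le_log_iff_pow_le (by norm_num) hN0.ne').2 hN
  have h4 := key (K + 1) (h3.trans K.le_succ)
  have h5 : ((Z ∩ Set.Iio N).ncard : ℝ) ≤ (Z ∩ Set.Iio (2 ^ (K + 1))).ncard := by
    exact_mod_cast Set.ncard_le_ncard (Set.inter_subset_inter_right _
      (Set.Iio_subset_Iio h2.le)) (hfin _)
  have h6 : (2 : ℝ) ^ K ≤ N := by exact_mod_cast h1
  have hNr : (0 : ℝ) < N := by exact_mod_cast hN0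
  rw [densityAt, div_add' _ _ _ hNr.ne']
  refine div_le_div_of_nonneg_right ?_ hNr.le
  -- The factor `4` arises because `N` may be as small as `2^K`, while the bound is taken at
  -- `2^(K+1)`.
  have h7 : ε * 2 ^ (K + 1 + 1) ≤ 4 * ε * N := by
    rw [pow_succ, pow_succ]
    nlinarith
  linarith

/-- Sets that agree from some point on are coarsely similar. -/
theorem upperDensity_symmDiff_eq_zero_of_eventually {A B : Set ℕ}
    (h : ∀ᶠ n in atTop, (n ∈ A ↔ n ∈ B)) : upperDensity (A ∆ B) = 0 := by
  obtain ⟨m, hm⟩ := eventually_atTop.1 h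
  refine le_antisymm ?_ (upperDensity_nonneg _)
  refine upperDensity_le_of_densityAt_le (c := m) (Eventually.of_forall fun n => ?_)
  rw [add_zero, densityAt]
  gcongr
  have hsub : (A ∆ B) ∩ Set.Iio n ⊆ Set.Iio m := by
    rintro x ⟨hx, -⟩
    by_contra hxm
    have := hm x (not_lt.1 hxm)
    rw [Set.mem_symmDiff] at hx
    tauto
  have := Set.ncard_le_ncard hsub (Set.finite_Iio m)
  rwa [← Finset.coe_Iio m, Set.ncard_coe_finset, Nat.card_Iio] at this

/-! ### Limits of fast Cauchy sequences -/

noncomputable section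

/-- `B i` and `B (n + 1)` differ on more than a fraction `4 * 2⁻ⁱ` of `[0, 2^(k+1))`,
for some `i ≤ n`, or `n ≥ k`. -/
def mixStop (B : ℕ → Set ℕ) (k n : ℕ) : Bool :=
  decide (k ≤ n) || decide (∃ i < n + 1, decide (4 * 2 ^ (k + 1) <
    2 ^ i * Nat.count (fun y => !decide (chi (B i) y = chi (B (n + 1)) y)) (2 ^ (k + 1))) = true)

theorem exists_mixStop (B : ℕ → Set ℕ) (k : ℕ) : ∃ n, mixStop B k n = true :=
  ⟨k, by simp [mixStop]⟩

/-- The index of the set that `mix B` copies on the block `[2^k, 2^(k+1))`. -/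
def mixIndex (B : ℕ → Set ℕ) (k : ℕ) : ℕ := Nat.find (exists_mixStop B k)

/-- A limit, for coarse similarity, of a fast Cauchy sequence `B`, which copies on each dyadic
block a member of the sequence. -/
def mix (B : ℕ → Set ℕ) : Set ℕ := {x | x ∈ B (mixIndex B (Nat.log 2 x))}

end

theorem count_ne_eq_ncard_symmDiff (A B : Set ℕ) (N : ℕ) :
    Nat.count (fun y => (!decide (chi A y = chi B y)) = true) N =
      ((A ∆ B) ∩ Set.Iio N).ncard := by
  refine (ncard_inter_Iio_eq_count (p := fun y => !decide (chi A y = chi B y))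
    (fun y => ?_) N).symm
  rw [Set.mem_symmDiff]
  by_cases h1 : y ∈ A <;> by_cases h2 : y ∈ B <;> simp [chi, h1, h2]

/-- The test is phrased with the denominator `2^i` cleared, to be computable on natural numbers;
this is its form for estimates. -/
theorem mixStop_eq_false_iff (B : ℕ → Set ℕ) (k n : ℕ) : mixStop B k n = false ↔
    n < k ∧ ∀ i ≤ n, (((B i) ∆ (B (n + 1)) ∩ Set.Iio (2 ^ (k + 1))).ncard : ℝ) ≤
      4 * (1 / 2) ^ i * 2 ^ (k + 1) := by
  simp only [mixStop, count_ne_eq_ncard_symmDiff, Bool.or_eq_false_iff, decide_eq_false_iff_not,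
    not_le, not_exists, not_and, decide_eq_true_eq, not_lt, Nat.lt_succ_iff]
  refine and_congr_right fun _ => forall₂_congr fun i _ => ?_
  rw [← Nat.cast_le (α := ℝ)]
  push_cast
  have h2 : (0 : ℝ) < 2 ^ i := by positivity
  rw [one_div, inv_pow, mul_comm (4 : ℝ) (_)⁻¹, mul_assoc, inv_mul_eq_div, le_div_iff₀ h2, mul_comm]

/-- The upper densities, at most `2 * 2⁻ⁱ`, lie strictly below the threshold `4 * 2⁻ⁱ`, so each `n`
passes the test for all large `k` and `mixIndex B k` tends to infinity. As the search passed the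
predecessor of `mixIndex B k`, the member copied on block `k` is within the threshold of `B i`. The
block estimate costs another factor `4`. -/
theorem upperDensity_symmDiff_mix_le {B : ℕ → Set ℕ}
    (hB : ∀ i j, i ≤ j → upperDensity (B i ∆ B j) ≤ 2 * (1 / 2) ^ i) (i : ℕ) :
    upperDensity (B i ∆ mix B) ≤ 16 * (1 / 2) ^ i := by
  have hpos : ∀ i : ℕ, (0 : ℝ) < (1 / 2) ^ i := fun i => by positivity
  have hmixStop : ∀ n, ∀ᶠ k in atTop, mixStop B k n = false := by
    intro n
    have hall : ∀ᶠ k : ℕ in atTop, ∀ i ∈ Finset.range (n + 1),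
        (((B i) ∆ (B (n + 1)) ∩ Set.Iio (2 ^ (k + 1))).ncard : ℝ) < 4 * (1 / 2) ^ i * 2 ^ (k + 1) := by
      refine (Finset.eventually_all _).2 fun i hi => eventually_ncard_lt_two_pow ?_
      have := hB i (n + 1) (Finset.mem_range.1 hi).le
      linarith [hpos i]
    filter_upwards [hall, eventually_gt_atTop n] with k hk hnk
    exact (mixStop_eq_false_iff B k n).2
      ⟨hnk, fun i hi => (hk i (Finset.mem_range.2 (Nat.lt_succ_of_le hi))).le⟩
  have hidx : ∀ᶠ k in atTop, i ≤ mixIndex B k := by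
    have hall : ∀ᶠ k in atTop, ∀ n ∈ Finset.range i, mixStop B k n = false :=
      (Finset.eventually_all _).2 fun n _ => hmixStop n
    filter_upwards [hall] with k hk
    refine (Nat.le_find_iff _ _).2 fun n hn => ?_
    simp [hk n (Finset.mem_range.2 hn)]
  have hblock : upperDensity (B i ∆ mix B) ≤ 4 * (4 * (1 / 2) ^ i) := by
    refine upperDensity_le_of_blocks (by have := hpos i; positivity) ?_
    filter_upwards [hidx] with k hk
    have hsub : (B i ∆ mix B) ∩ Set.Ico (2 ^ k) (2 ^ (k + 1)) ⊆
        (B i ∆ B (mixIndex B k)) ∩ Set.Iio (2 ^ (k + 1)) := by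
      rintro x ⟨hx, h1, h2⟩
      refine ⟨?_, h2⟩
      have hlog : Nat.log 2 x = k := Nat.log_eq_of_pow_le_of_lt_pow h1 h2
      have hm : x ∈ mix B ↔ x ∈ B (mixIndex B k) := by
        change x ∈ B (mixIndex B (Nat.log 2 x)) ↔ _
        rw [hlog]
      rw [Set.mem_symmDiff] at hx ⊢
      rwa [hm] at hx
    have hcard : (((B i ∆ mix B) ∩ Set.Ico (2 ^ k) (2 ^ (k + 1))).ncard : ℝ) ≤
        ((B i ∆ B (mixIndex B k)) ∩ Set.Iio (2 ^ (k + 1))).ncard := by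
      exact_mod_cast Set.ncard_le_ncard hsub ((Set.finite_Iio _).inter_of_right _)
    refine hcard.trans ?_
    rcases hk.eq_or_lt with h | h
    · rw [← h]
      have := hpos i
      simp only [symmDiff_self, Set.bot_eq_empty, Set.empty_inter, Set.ncard_empty, Nat.cast_zero]
      positivity
    · obtain ⟨m, hm⟩ : ∃ m, mixIndex B k = m + 1 := ⟨mixIndex B k - 1, by omega⟩
      have hns := Nat.find_min (exists_mixStop B k) (m := m) (by rw [mixIndex] at hm; omega)
      rw [Bool.not_eq_true, mixStop_eq_false_iff] at hns
      rw [hm]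
      exact hns.2 i (by omega)
  linarith

theorem tendsto_coarseClass_mix {B : ℕ → Set ℕ}
    (hB : ∀ i j, i ≤ j → upperDensity (B i ∆ B j) ≤ 2 * (1 / 2) ^ i) :
    Tendsto (fun i => coarseClass (B i)) atTop (𝓝 (coarseClass (mix B))) := by
  rw [tendsto_iff_dist_tendsto_zero]
  refine squeeze_zero (fun _ => dist_nonneg) (fun i => upperDensity_symmDiff_mix_le hB i) ?_
  simpa using (tendsto_pow_atTop_nhds_zero_of_lt_one (by norm_num : (0 : ℝ) ≤ 1 / 2)
    (by norm_num)).const_mul 16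

instance CoarseClass.instCompleteSpace : CompleteSpace CoarseClass := by
  refine Metric.complete_of_convergent_controlled_sequences (fun n => (1 / 2) ^ n)
    (fun n => by positivity) fun u hu => ?_
  choose B hB using fun n => Quotient.exists_rep (u n)
  have hB' : (fun n => coarseClass (B n)) = u := funext hB
  refine ⟨coarseClass (mix B), hB' ▸ tendsto_coarseClass_mix fun i j hij => ?_⟩
  have h := hu i i j le_rfl hij
  rw [← hB'] at h
  have h' : upperDensity (B i ∆ B j) < (1 / 2) ^ i := h
  have : (0 : ℝ) < (1 / 2) ^ i := by positivity
  linarith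

theorem ComputableIn.log_two {α : Type*} [Primcodable α] {O : Set (ℕ →. ℕ)} {f : α → ℕ}
    (hf : ComputableIn O f) : ComputableIn O fun a => Nat.log 2 (f a) := by
  have hex : ∀ x, ∃ k, decide (x < 2 ^ (k + 1)) = true := fun x =>
    ⟨Nat.log 2 x, by simpa using Nat.lt_pow_succ_log_self (by norm_num) x⟩
  refine comp (f := fun x => Nat.log 2 x) (((find (O := O) (p := fun x k => decide (x < 2 ^ (k + 1)))
    (decide_lt .fst (two_pow (add .snd (.const 1)))) hex)).of_eq fun x => ?_) hf
  rw [Nat.find_eq_iff]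
  refine ⟨by simpa using Nat.lt_pow_succ_log_self (by norm_num) x, fun m hm => ?_⟩
  simpa using Nat.pow_le_of_le_log (by rintro rfl; simp at hm) (Nat.succ_le_of_lt hm)

/-- The stopping test only compares finite counts, and its clause `k ≤ n` makes the search total
without any Cauchy assumption. -/
theorem turingLE_mix {C : Set ℕ} {B : ℕ → Set ℕ}
    (hB : SetComputable C fun q : ℕ × ℕ => chi (B q.1) q.2) : TuringLE (mix B) C := by
  have hB' : ∀ {α : Type} [Primcodable α] {f g : α → ℕ}, SetComputable C f → SetComputable C g →
      SetComputable C fun a => chi (B (f a)) (g a) := fun hf hg => hB.comp (hf.pair hg)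
  have hmixStop : ComputableIn₂ {charFn C} (mixStop B) := by
    refine ComputableIn.or (ComputableIn.decide_le .fst .snd) ?_
    refine ComputableIn.exists_lt (p := fun (q : ℕ × ℕ) i => decide (4 * 2 ^ (q.1 + 1) <
      2 ^ i * Nat.count (fun y => (!decide (chi (B i) y = chi (B (q.2 + 1)) y)) = true)
        (2 ^ (q.1 + 1)))) ?_ (ComputableIn.add .snd (.const 1))
    have hpow : SetComputable C fun a : (ℕ × ℕ) × ℕ => 2 ^ (a.1.1 + 1) :=
      ComputableIn.two_pow (ComputableIn.add (ComputableIn.fst.comp .fst) (.const 1))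
    refine ComputableIn.decide_lt (ComputableIn.mul (.const 4) hpow)
      (ComputableIn.mul (ComputableIn.two_pow .snd) ?_)
    refine ComputableIn.count (p := fun (a : (ℕ × ℕ) × ℕ) y =>
      !decide (chi (B a.2) y = chi (B (a.1.2 + 1)) y)) ?_ hpow
    exact ComputableIn.not (ComputableIn.decide_eq (hB' (ComputableIn.snd.comp .fst) .snd)
      (hB' (ComputableIn.add (ComputableIn.snd.comp (ComputableIn.fst.comp .fst)) (.const 1)) .snd))
  have hidx : SetComputable C (mixIndex B) := ComputableIn.find hmixStop (exists_mixStop B)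
  exact TuringLE.iff.2 (hB' (hidx.comp (ComputableIn.log_two .id)) .id)

/-! ### The two conditions imply closedness -/

/-- If `C` computes every `A n`, and the jump of `D` computes indices for these computations, then
finite modifications of the `A n` are uniformly computable in `C ⊕ D`. -/
theorem exists_uniform_finite_modification {C D : Set ℕ} {A : ℕ → Set ℕ} {e : ℕ → ℕ}
    (he : ∀ n, turingFunctional (e n) C = charFn (A n)) (hD : SetComputable (turingJump D) e) :
    ∃ B : ℕ → Set ℕ, SetComputable (turingJoin C D) (fun q : ℕ × ℕ => chi (B q.1) q.2) ∧
      ∀ n, ∀ᶠ x in atTop, (x ∈ B n ↔ x ∈ A n) := by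
  obtain ⟨g, hg, hlim⟩ := hD.exists_limit_of_turingJump
  have hdef : ∀ n x, ∃ y, y ∈ turingFunctional (e n) C x := fun n x => by
    rw [he]; exact ⟨_, Part.mem_some _⟩
  -- Late stages have the correct index and a halted computation, so the search succeeds. Requiring
  -- the stage to be at least `x` forces the guess to be correct once `x` passes the point where the
  -- guesses for `n` have settled.
  have hex : ∀ q : ℕ × ℕ, ∃ s, (decide (q.2 ≤ s) &&
      (stageValue (g (q.1, s)) q.2 s (initSeg C s)).isSome) = true := by
    rintro ⟨n, x⟩
    obtain ⟨y, hy⟩ := hdef n x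
    obtain ⟨s, ⟨h1, h2⟩, h3⟩ := (((hlim n).and (eventually_stageValue_initSeg hy)).and
      (eventually_ge_atTop x)).exists
    exact ⟨s, by simp [h1, h2, h3]⟩
  have hg' := hg.mono (turingLE_join_right C D)
  have hC := (setComputable_initSeg C).mono (turingLE_join_left C D)
  have hstage : SetComputable (turingJoin C D) fun a : (ℕ × ℕ) × ℕ =>
      stageValue (g (a.1.1, a.2)) a.1.2 a.2 (initSeg C a.2) :=
    ComputableIn.stageValue (hg'.comp ((ComputableIn.fst.comp .fst).pair .snd))
      (ComputableIn.snd.comp .fst) .snd (hC.comp .snd)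
  have hfind : SetComputable (turingJoin C D) fun q => Nat.find (hex q) := by
    refine ComputableIn.find (p := fun (q : ℕ × ℕ) s => decide (q.2 ≤ s) &&
      (stageValue (g (q.1, s)) q.2 s (initSeg C s)).isSome) ?_ hex
    exact ComputableIn.and (ComputableIn.decide_le (ComputableIn.snd.comp .fst) .snd)
      (ComputableIn.comp (f := Option.isSome) Primrec.option_isSome.computableIn hstage)
  refine ⟨fun n => {x | stageValue (g (n, Nat.find (hex (n, x)))) x (Nat.find (hex (n, x)))
    (initSeg C (Nat.find (hex (n, x)))) = some 1}, ?_, fun n => ?_⟩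
  · refine (ComputableIn.decide_eq (hstage.comp (ComputableIn.id.pair hfind))
      (.const (some 1))).of_eq fun q => ?_
    rw [Bool.eq_iff_iff, chi_eq_true, decide_eq_true_eq]
    rfl
  · obtain ⟨m, hm⟩ := eventually_atTop.1 (hlim n)
    filter_upwards [eventually_ge_atTop m] with x hx
    have h := Nat.find_spec (hex (n, x))
    rw [Bool.and_eq_true, decide_eq_true_eq, Option.isSome_iff_exists] at h
    obtain ⟨hxs, y, hy⟩ := h
    dsimp only at hxs hy
    rw [hy]
    rw [hm _ (hx.trans hxs)] at hy
    have hval := mem_turingFunctional_of_stageValue hy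
    rw [he, charFn, Part.mem_some_iff] at hval
    by_cases hA : x ∈ A n <;> simp [hval, hA]

theorem IsTuringIdeal.exists_uniform_finite_modification {U : Set (Set ℕ)} (hU : IsTuringIdeal U)
    (hjump : JumpCofinal U) (hbdd : CountableSubsetsBounded U) {A : ℕ → Set ℕ}
    (hA : ∀ n, A n ∈ U) :
    ∃ E ∈ U, ∃ B : ℕ → Set ℕ, SetComputable E (fun q : ℕ × ℕ => chi (B q.1) q.2) ∧
      ∀ n, ∀ᶠ x in atTop, (x ∈ B n ↔ x ∈ A n) := by
  obtain ⟨C, hC, hAC⟩ := hbdd (Set.range A) (Set.range_subset_iff.2 hA) (Set.countable_range A)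
  choose e he using fun n => (charFn_recursiveIn_iff C (charFn (A n))).1 (hAC _ ⟨n, rfl⟩)
  -- Jump-cofinality speaks of sets, so it is applied to the graph of the index sequence, from which
  -- `e` is recovered by search.
  obtain ⟨D, hD, hX⟩ := hjump {z | e z.unpair.1 = z.unpair.2}
  have hex : ∀ n, ∃ m, chi {z | e z.unpair.1 = z.unpair.2} (Nat.pair n m) = true := fun n =>
    ⟨e n, by simp⟩
  have heD : SetComputable (turingJump D) e := by
    refine (ComputableIn.find (p := fun n m => chi {z | e z.unpair.1 = z.unpair.2} (Nat.pair n m))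
      ((TuringLE.iff.1 hX).comp Primrec₂.natPair.computableIn) hex).of_eq fun n => ?_
    have h : e n = Nat.find (hex n) := by simpa using Nat.find_spec (hex n)
    exact h.symm
  exact ⟨_, hU.join C D hC hD, _root_.exists_uniform_finite_modification he heD⟩

theorem IsTuringIdeal.isClosed_generatedSubspace {U : Set (Set ℕ)} (hU : IsTuringIdeal U)
    (hjump : JumpCofinal U) (hbdd : CountableSubsetsBounded U) :
    IsClosed (generatedSubspace U) := by
  refine isClosed_of_closure_subset fun a ha => ?_
  obtain ⟨X, rfl⟩ : ∃ X, coarseClass X = a := Quotient.exists_rep a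
  have hpos : ∀ i : ℕ, (0 : ℝ) < (1 / 2) ^ i := fun i => by positivity
  have happrox : ∀ n : ℕ, ∃ A ∈ U, upperDensity (X ∆ A) < (1 / 2) ^ n := by
    intro n
    obtain ⟨_, ⟨A, hA, rfl⟩, hd⟩ := Metric.mem_closure_iff.1 ha _ (hpos n)
    exact ⟨A, hA, hd⟩
  choose A hAU hA using happrox
  obtain ⟨E, hE, B, hB, hBA⟩ := hU.exists_uniform_finite_modification hjump hbdd hAU
  have hXB : ∀ n, upperDensity (X ∆ B n) < (1 / 2) ^ n := fun n => by
    have h1 := upperDensity_symmDiff_eq_zero_of_eventually (hBA n)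
    have h2 := upperDensity_triangle X (A n) (B n)
    rw [upperDensity_symmDiff_comm] at h1
    linarith [hA n]
  have hcauchy : ∀ i j, i ≤ j → upperDensity (B i ∆ B j) ≤ 2 * (1 / 2) ^ i := by
    intro i j hij
    have h1 := upperDensity_triangle (B i) X (B j)
    rw [upperDensity_symmDiff_comm (B i) X] at h1
    have h2 : ((1 : ℝ) / 2) ^ j ≤ (1 / 2) ^ i :=
      pow_le_pow_of_le_one (by norm_num) (by norm_num) hij
    linarith [hXB i, hXB j]
  have hlim : Tendsto (fun i => coarseClass (B i)) atTop (𝓝 (coarseClass X)) := by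
    rw [tendsto_iff_dist_tendsto_zero]
    refine squeeze_zero (fun _ => dist_nonneg) (fun i => ?_)
      (tendsto_pow_atTop_nhds_zero_of_lt_one (by norm_num : (0 : ℝ) ≤ 1 / 2) (by norm_num))
    rw [dist_comm]
    exact (hXB i).le
  -- `X` itself need not lie in `U`; its class equals that of `mix B` since both are limits of the
  -- classes of the `B n`.
  exact ⟨mix B, hU.downward E _ hE (turingLE_mix hB),
    tendsto_nhds_unique (tendsto_coarseClass_mix hcauchy) hlim⟩

/-! ### Coding a sequence of sets robustly -/

noncomputable section

/-- The set whose column `{x | x ≡ 2^n mod 2^(n+1)}` carries, for every `k`, the information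
whether `k ∈ Y n` on the dyadic block `[2^k, 2^(k+1))`. -/
def blockCode (Y : ℕ → Set ℕ) : Set ℕ := {x | ∃ n, x % 2 ^ (n + 1) = 2 ^ n ∧ Nat.log 2 x ∈ Y n}

/-- The part of `blockCode Y` on the first `N` columns. -/
def blockCodeBelow (Y : ℕ → Set ℕ) (N : ℕ) : Set ℕ :=
  {x | ∃ n < N, x % 2 ^ (n + 1) = 2 ^ n ∧ Nat.log 2 x ∈ Y n}

/-- The number of elements of `D` in the `n`-th column of the block `[2^k, 2^(k+1))` exceeds half
of the size of that column. -/
def blockVote (D : Set ℕ) (q : ℕ × ℕ) : Bool :=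
  decide (2 ^ q.2 < 2 ^ (q.1 + 2) * Nat.count (fun y => (decide (2 ^ q.2 ≤ y) &&
    decide (y % 2 ^ (q.1 + 1) = 2 ^ q.1) && chi D y) = true) (2 ^ (q.2 + 1)))

end

theorem setComputable_blockVote (D : Set ℕ) : SetComputable D (blockVote D) := by
  refine ComputableIn.decide_lt (ComputableIn.two_pow .snd) (ComputableIn.mul
    (ComputableIn.two_pow (ComputableIn.add .fst (.const 2))) (ComputableIn.count
    (p := fun (q : ℕ × ℕ) y => decide (2 ^ q.2 ≤ y) && decide (y % 2 ^ (q.1 + 1) = 2 ^ q.1) &&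
      chi D y) ?_ (ComputableIn.two_pow (ComputableIn.add .snd (.const 1)))))
  have h1 : SetComputable D fun a : (ℕ × ℕ) × ℕ => a.1.1 := ComputableIn.fst.comp .fst
  have h2 : SetComputable D fun a : (ℕ × ℕ) × ℕ => a.1.2 := ComputableIn.snd.comp .fst
  exact ComputableIn.and (ComputableIn.and (ComputableIn.decide_le (ComputableIn.two_pow h2) .snd)
    (ComputableIn.decide_eq (ComputableIn.mod .snd (ComputableIn.two_pow
      (ComputableIn.add h1 (.const 1)))) (ComputableIn.two_pow h1)))
    ((setComputable_chi D).comp .snd)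

theorem two_pow_dvd_of_mod_eq {x n N : ℕ} (h : x % 2 ^ (n + 1) = 2 ^ n) (hN : N ≤ n) :
    2 ^ N ∣ x := by
  refine (pow_dvd_pow 2 hN).trans ?_
  rw [← Nat.div_add_mod x (2 ^ (n + 1)), h]
  exact dvd_add ((pow_dvd_pow 2 n.le_succ).mul_right _) dvd_rfl

theorem mod_two_pow_unique {x n m : ℕ} (hn : x % 2 ^ (n + 1) = 2 ^ n)
    (hm : x % 2 ^ (m + 1) = 2 ^ m) : n = m := by
  by_contra hne
  wlog hlt : n < m generalizing n m
  · exact this hm hn (Ne.symm hne) (by omega)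
  have h := Nat.mod_eq_zero_of_dvd (two_pow_dvd_of_mod_eq hm hlt)
  rw [hn] at h
  exact (pow_pos (by norm_num : 0 < 2) n).ne' h

/-- Columns with index at least `N` consist of multiples of `2^N`. -/
theorem upperDensity_blockCode_symmDiff_le (Y : ℕ → Set ℕ) (N : ℕ) :
    upperDensity (blockCode Y ∆ blockCodeBelow Y N) ≤ (1 / 2) ^ N := by
  have hsub : blockCode Y ∆ blockCodeBelow Y N ⊆ {x | 2 ^ N ∣ x} := by
    intro x hx
    rcases Set.mem_symmDiff.1 hx with ⟨⟨n, hn, hY⟩, h⟩ | ⟨⟨n, hnN, hn, hY⟩, h⟩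
    · refine two_pow_dvd_of_mod_eq hn (not_lt.1 fun hlt => h ⟨n, hlt, hn, hY⟩)
    · exact absurd ⟨n, hn, hY⟩ h
  refine (upperDensity_mono hsub).trans (upperDensity_le_of_densityAt_le (c := 1) ?_)
  filter_upwards [eventually_gt_atTop 0] with n hn
  have hcount : ({x | 2 ^ N ∣ x} ∩ Set.Iio n).ncard ≤ n / 2 ^ N + 1 := by
    have hs : {x | 2 ^ N ∣ x} ∩ Set.Iio n ⊆
        ((Finset.range (n / 2 ^ N + 1)).image (2 ^ N * ·) : Finset ℕ) := by
      rintro _ ⟨⟨j, rfl⟩, hj⟩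
      simp only [Finset.coe_image, Set.mem_image, Finset.coe_range, Set.mem_Iio]
      refine ⟨j, Nat.lt_succ_of_le ((Nat.le_div_iff_mul_le (by positivity)).2 ?_), rfl⟩
      rw [mul_comm]
      exact (Set.mem_Iio.1 hj).le
    refine (Set.ncard_le_ncard hs (Finset.finite_toSet _)).trans ?_
    rw [Set.ncard_coe_finset]
    exact Finset.card_image_le.trans (Finset.card_range _).le
  have hn' : (0 : ℝ) < n := by exact_mod_cast hn
  rw [densityAt, div_add' _ _ _ hn'.ne']
  refine div_le_div_of_nonneg_right ?_ hn'.le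
  have h1 : (({x | 2 ^ N ∣ x} ∩ Set.Iio n).ncard : ℝ) ≤ ((n / 2 ^ N : ℕ) : ℝ) + 1 := by
    exact_mod_cast hcount
  have h2 : ((n / 2 ^ N : ℕ) : ℝ) ≤ (n : ℝ) / 2 ^ N := by
    exact_mod_cast Nat.cast_div_le (α := ℝ) (m := n) (n := 2 ^ N)
  rw [one_div_pow, one_div_mul_eq_div]
  linarith

/-- Since `2^(n+1)` divides `2^k`, the block `[2^k, 2^(k+1))` splits into `2^(k-n-1)` full periods,
each with one point of the column. -/
theorem two_pow_le_card_column {n k : ℕ} (h : n < k) :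
    2 ^ k ≤ 2 ^ (n + 1) * (((Finset.range (2 ^ (k + 1))).filter fun y =>
      2 ^ k ≤ y ∧ y % 2 ^ (n + 1) = 2 ^ n).card) := by
  obtain ⟨d, rfl⟩ : ∃ d, k = n + 1 + d := ⟨k - (n + 1), by omega⟩
  rw [pow_add 2 (n + 1) d]
  refine Nat.mul_le_mul_left _ ?_
  have hinj : Function.Injective fun j : ℕ => 2 ^ (n + 1) * (2 ^ d + j) + 2 ^ n := by
    intro i j hij
    simpa using hij
  refine ((Finset.card_image_of_injective _ hinj).trans (Finset.card_range (2 ^ d))).ge.trans ?_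
  refine Finset.card_le_card fun y hy => ?_
  obtain ⟨j, hj, rfl⟩ := Finset.mem_image.1 hy
  rw [Finset.mem_range] at hj
  have hn : 2 ^ n < 2 ^ (n + 1) := Nat.pow_lt_pow_succ (by norm_num)
  have hpos : 0 < 2 ^ (n + 1) := by positivity
  simp only [Finset.mem_filter, Finset.mem_range]
  refine ⟨?_, ?_, ?_⟩
  · have h1 : 2 ^ (n + 1) * (2 ^ d + j + 1) ≤ 2 ^ (n + 1) * (2 * 2 ^ d) :=
      Nat.mul_le_mul_left _ (by omega)
    have h2 : 2 ^ (n + 1 + d + 1) = 2 ^ (n + 1) * (2 * 2 ^ d) := by ring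
    rw [h2]
    rw [mul_add _ _ 1, mul_one] at h1
    omega
  · rw [mul_add]; omega
  · rw [Nat.mul_add_mod, Nat.mod_eq_of_lt hn]

/-- On one column of one block the code is constant, while an error set of density zero eventually
covers less than half of that fixed proportion of the block. -/
theorem eventually_blockVote_eq {Y : ℕ → Set ℕ} {D : Set ℕ}
    (h : upperDensity (blockCode Y ∆ D) = 0) (n : ℕ) :
    ∀ᶠ k in atTop, blockVote D (n, k) = chi (Y n) k := by
  -- With this tolerance there are fewer than `2⁻⁽ⁿ⁺³⁾ * 2^(k+1) = 2^(k-n-2)` errors below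
  -- `2^(k+1)`, which is half of the `2^(k-n-1)` points of the column.
  have hpos : (0 : ℝ) < (1 / 2) ^ (n + 3) := by positivity
  filter_upwards [eventually_ncard_lt_two_pow (h.trans_lt hpos), eventually_gt_atTop n] with k hk hnk
  classical
  set T := (Finset.range (2 ^ (k + 1))).filter fun y => 2 ^ k ≤ y ∧ y % 2 ^ (n + 1) = 2 ^ n with hT
  set err := ((blockCode Y ∆ D) ∩ Set.Iio (2 ^ (k + 1))).ncard with herr
  have herrlt : 2 ^ (n + 2) * err < 2 ^ k := by
    have h8 : (2 : ℝ) ^ (n + 3) * (1 / 2) ^ (n + 3) = 1 := by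
      rw [← mul_pow]; norm_num
    have h9 : (2 : ℝ) ^ (n + 3) * err < 2 ^ (k + 1) := by
      calc (2 : ℝ) ^ (n + 3) * err < 2 ^ (n + 3) * ((1 / 2) ^ (n + 3) * 2 ^ (k + 1)) :=
            mul_lt_mul_of_pos_left hk (by positivity)
        _ = 2 ^ (k + 1) := by rw [← mul_assoc, h8, one_mul]
    have h10 : 2 ^ (n + 3) * err < 2 ^ (k + 1) := by exact_mod_cast h9
    rw [pow_succ 2 (n + 2), pow_succ 2 k] at h10
    nlinarith
  have hcount : Nat.count (fun y => (decide (2 ^ k ≤ y) &&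
      decide (y % 2 ^ (n + 1) = 2 ^ n) && chi D y) = true) (2 ^ (k + 1)) =
      (T.filter (· ∈ D)).card := by
    rw [Nat.count_eq_card_filter_range, hT, Finset.filter_filter]
    congr 1
    ext y
    simp
  have hmem : ∀ y ∈ T, (y ∈ blockCode Y ↔ k ∈ Y n) := by
    intro y hy
    rw [hT, Finset.mem_filter, Finset.mem_range] at hy
    have hlog : Nat.log 2 y = k := Nat.log_eq_of_pow_le_of_lt_pow hy.2.1 hy.1
    constructor
    · rintro ⟨m, hm, hY⟩
      rw [mod_two_pow_unique hm hy.2.2, hlog] at hY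
      exact hY
    · intro hY
      exact ⟨n, hy.2.2, by rwa [hlog]⟩
  have hle : ∀ S : Finset ℕ, S ⊆ T → (∀ y ∈ S, y ∈ blockCode Y ∆ D) → S.card ≤ err := by
    intro S hS hSd
    rw [herr, ← Set.ncard_coe_finset]
    refine Set.ncard_le_ncard (fun y hy => ⟨hSd y hy, ?_⟩) ((Set.finite_Iio _).inter_of_right _)
    exact Finset.mem_range.1 (Finset.mem_filter.1 (hS hy)).1
  have hsize := two_pow_le_card_column hnk
  rw [← hT] at hsize
  have hsplit := Finset.card_filter_add_card_filter_not (s := T) (· ∈ D)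
  have hvote : blockVote D (n, k) = decide (2 ^ k < 2 ^ (n + 2) * (T.filter (· ∈ D)).card) := by
    simp only [blockVote, hcount]
  by_cases hY : k ∈ Y n
  · have h1 : (T.filter fun y => ¬ y ∈ D).card ≤ err :=
      hle _ (Finset.filter_subset _ _) fun y hy =>
        Or.inl ⟨(hmem y (Finset.mem_filter.1 hy).1).2 hY, (Finset.mem_filter.1 hy).2⟩
    rw [hvote, chi_eq_true.2 hY, decide_eq_true_eq]
    have h2 := Nat.mul_le_mul_left (2 ^ (n + 2)) h1
    have h3 : 2 ^ (n + 2) * T.card = 2 ^ (n + 2) * (T.filter (· ∈ D)).card +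
      2 ^ (n + 2) * (T.filter fun y => ¬ y ∈ D).card := by rw [← mul_add, hsplit]
    have h4 : 2 ^ (n + 2) * T.card = 2 * (2 ^ (n + 1) * T.card) := by ring
    omega
  · have h1 : (T.filter (· ∈ D)).card ≤ err :=
      hle _ (Finset.filter_subset _ _) fun y hy =>
        Or.inr ⟨(Finset.mem_filter.1 hy).2,
          fun hb => hY ((hmem y (Finset.mem_filter.1 hy).1).1 hb)⟩
    rw [hvote, chi_eq_false.2 hY, decide_eq_false_iff_not, not_lt]
    exact (Nat.mul_le_mul_left _ h1).trans herrlt.le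

/-! ### Closedness implies the two conditions -/

theorem IsTuringIdeal.mem_of_computable {U : Set (Set ℕ)} (hU : IsTuringIdeal U)
    (hne : U.Nonempty) {A : Set ℕ} (hA : Computable (chi A)) : A ∈ U := by
  obtain ⟨C, hC⟩ := hne
  exact hU.downward C A hC (TuringLE.iff.2 hA.computableIn)

/-- Finitely many columns need only finitely many joins, so no uniformity in `Y` is required. -/
theorem IsTuringIdeal.blockCodeBelow_mem {U : Set (Set ℕ)} (hU : IsTuringIdeal U)
    (hne : U.Nonempty) {Y : ℕ → Set ℕ} (hY : ∀ n, Y n ∈ U) (N : ℕ) : blockCodeBelow Y N ∈ U := by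
  induction N with
  | zero =>
    have h : chi (blockCodeBelow Y 0) = fun _ => false := by
      funext x; simp [blockCodeBelow]
    exact hU.mem_of_computable hne (h ▸ Computable.const false)
  | succ N ih =>
    refine hU.downward _ _ (hU.join _ _ ih (hY N)) (TuringLE.iff.2 ?_)
    have h1 := TuringLE.iff.1 (turingLE_join_left (blockCodeBelow Y N) (Y N))
    have h2 := TuringLE.iff.1 (turingLE_join_right (blockCodeBelow Y N) (Y N))
    refine (ComputableIn.or h1 (ComputableIn.and (ComputableIn.decide_eq
      (ComputableIn.mod .id (.const (2 ^ (N + 1)))) (.const (2 ^ N)))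
      (h2.comp (ComputableIn.log_two .id)))).of_eq fun x => ?_
    rw [Bool.eq_iff_iff, Bool.or_eq_true, Bool.and_eq_true, chi_eq_true, chi_eq_true, chi_eq_true,
      decide_eq_true_eq]
    constructor
    · rintro (⟨n, hn, h⟩ | h)
      · exact ⟨n, hn.trans N.lt_succ_self, h⟩
      · exact ⟨N, N.lt_succ_self, h⟩
    · rintro ⟨n, hn, h⟩
      rcases Nat.lt_succ_iff_lt_or_eq.1 hn with hn | rfl
      · exact Or.inl ⟨n, hn, h⟩
      · exact Or.inr h

/-- If the generated subspace is closed, then finite modifications of any sequence of members of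
the ideal are uniformly computable in some member. -/
theorem IsTuringIdeal.exists_uniform_of_isClosed {U : Set (Set ℕ)} (hU : IsTuringIdeal U)
    (hne : U.Nonempty) (hcl : IsClosed (generatedSubspace U)) {Y : ℕ → Set ℕ}
    (hY : ∀ n, Y n ∈ U) :
    ∃ D ∈ U, ∃ g : ℕ × ℕ → Bool, SetComputable D g ∧
      ∀ n, ∀ᶠ k in atTop, g (n, k) = chi (Y n) k := by
  have hlim : Tendsto (fun N => coarseClass (blockCodeBelow Y N)) atTop
      (𝓝 (coarseClass (blockCode Y))) := by
    rw [tendsto_iff_dist_tendsto_zero]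
    refine squeeze_zero (fun _ => dist_nonneg) (fun N => ?_)
      (tendsto_pow_atTop_nhds_zero_of_lt_one (by norm_num : (0 : ℝ) ≤ 1 / 2) (by norm_num))
    rw [dist_comm]
    exact upperDensity_blockCode_symmDiff_le Y N
  obtain ⟨D, hD, hDB⟩ := hcl.mem_of_tendsto hlim
    (Eventually.of_forall fun N => ⟨_, hU.blockCodeBelow_mem hne hY N, rfl⟩)
  refine ⟨D, hD, blockVote D, setComputable_blockVote D, eventually_blockVote_eq ?_⟩
  rw [upperDensity_symmDiff_comm, ← dist_coarseClass, hDB, dist_self]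

/-- The finitely many values that may be wrong are stored in a constant string. -/
theorem turingLE_of_eventually_eq {A D : Set ℕ} {g : ℕ → Bool} (hg : SetComputable D g)
    (h : ∀ᶠ k in atTop, g k = chi A k) : TuringLE A D := by
  obtain ⟨m, hm⟩ := eventually_atTop.1 h
  refine TuringLE.iff.2 ((ComputableIn.cond (ComputableIn.decide_lt .id (.const m))
    (ComputableIn.comp₂ (f := fun (l : List Bool) n => l.getD n false)
      (Primrec.list_getD false).computableIn₂ (.const (initSeg A m)) .id) hg).of_eq fun k => ?_)
  by_cases hk : k < m
  · simp [hk, initSeg_eq_map_chi]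
  · simp [hk, hm k (not_lt.1 hk)]

/-- Each bit of `X` becomes a constant, hence computable, set; recovering these sets up to finite
errors exhibits `X` as a pointwise limit. -/
theorem IsTuringIdeal.jumpCofinal_of_isClosed {U : Set (Set ℕ)} (hU : IsTuringIdeal U)
    (hne : U.Nonempty) (hcl : IsClosed (generatedSubspace U)) : JumpCofinal U := by
  intro X
  have hconst : ∀ n, {_k : ℕ | n ∈ X} ∈ U := fun n => by
    have h : chi {_k : ℕ | n ∈ X} = fun _ => chi X n := rfl
    exact hU.mem_of_computable hne (h ▸ Computable.const _)
  obtain ⟨D, hD, g, hg, hlim⟩ := hU.exists_uniform_of_isClosed hne hcl hconst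
  exact ⟨D, hD, hg.turingJump_of_limit hlim⟩

/-- A bound need not compute the members uniformly, so the finite errors can be corrected for each
`n` separately. -/
theorem IsTuringIdeal.countableSubsetsBounded_of_isClosed {U : Set (Set ℕ)} (hU : IsTuringIdeal U)
    (hne : U.Nonempty) (hcl : IsClosed (generatedSubspace U)) : CountableSubsetsBounded U := by
  intro V hVU hV
  rcases V.eq_empty_or_nonempty with rfl | hVne
  · obtain ⟨C, hC⟩ := hne
    exact ⟨C, hC, fun A hA => hA.elim⟩
  obtain ⟨Y, rfl⟩ := hV.exists_eq_range hVne
  obtain ⟨D, hD, g, hg, hlim⟩ := hU.exists_uniform_of_isClosed hne hcl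
    fun n => hVU ⟨n, rfl⟩
  refine ⟨D, hD, ?_⟩
  rintro _ ⟨n, rfl⟩
  exact turingLE_of_eventually_eq (hg.comp ((ComputableIn.const n).pair .id)) (hlim n)

theorem mainTheorem5 (U : Set (Set ℕ)) (hU : IsTuringIdeal U)
    (hne : (generatedSubspace U).Nonempty) :
    (IsClosed (generatedSubspace U) ↔ IsComplete (generatedSubspace U)) ∧
      (IsClosed (generatedSubspace U) ↔ (JumpCofinal U ∧ CountableSubsetsBounded U)) := by
  have hne' : U.Nonempty := Set.image_nonempty.1 hne
  exact ⟨⟨fun h => h.isComplete, fun h => h.isClosed⟩,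
    fun h => ⟨hU.jumpCofinal_of_isClosed hne' h, hU.countableSubsetsBounded_of_isClosed hne' h⟩,
    fun h => hU.isClosed_generatedSubspace h.1 h.2⟩
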